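/- Let $f:(0,\infty)\to[0,\infty)$ be real-analytic, let $\varepsilon>0$ and $\eta_0>0$ be constants, and consider for $t\ge 0$, $x\in\mathbb R$ the one-dimensional pressureless Euler--Poisson (cold plasma) system with density-dependent damping $\nu(n)=\varepsilon f(n)$, $$V_t+VV_x=-E-\varepsilon f(n)\,V,\qquad E_t+VE_x=V,\qquad n=1-E_x>0,$$ with affine initial data $V(0,x)=a_0x+A_0$, $E(0,x)=b_0x+B_0$, where $a_0,A_0,b_0,B_0\in\mathbb R$ and $b_0<1$. Solutions are understood to be real-analytic in $(t,x)$ on $[0,T)\times\mathbb R$ with $0<T\le\infty$. (i) If $\displaystyle\int_{\eta_0}^{\infty}\frac{f(\eta)}{\eta^2}\,d\eta=\infty$, then for every choice of such data the Cauchy problem has a solution on $[0,\infty)\times\mathbb R$; it is unique (every solution on some $[0,T')\times\mathbb R$ agrees with it there), it is affine in $x$ for each $t$, i.e. $V=a(t)x+A(t)$, $E=b(t)x+B(t)$, and its derivatives $V_x$ and $E_x$ are bounded on $[0,\infty)\times\mathbb R$. (ii) If $\displaystyle\int_{\eta_0}^{\infty}\frac{f(\eta)}{\eta^2}\,d\eta<\infty$,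 then there are such data and a finite time $T>0$ for which the Cauchy problem has a solution on $[0,T)\times\mathbb R$; it is unique (every solution on some $[0,T')\times\mathbb R$ agrees with it at the common times), it is affine in $x$ for each $t$, and its derivatives blow up in finite time: $|V_x(t,x)|\to\infty$ and $|E_x(t,x)|\to\infty$ as $t\to T^-$, for every $x$. -/

import Mathlib

open Set Filter Topology MeasureTheory

namespace ColdPlasma

/-- The electron density `n = 1 - ∂E/∂x` at time `t` and point `x`. -/
noncomputable def density (E : ℝ → ℝ → ℝ) (t x : ℝ) : ℝ :=
  1 - deriv (E t) x

/-- `(V, E)` (functions of time and space, in this order) is a real-analytic solution, on the time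
set `I` and the whole line, of the Cauchy problem
`V_t + V V_x = -E - ν(n) V`, `E_t + V E_x = V`, `n = 1 - E_x > 0`, `V(0,·) = V₀`, `E(0,·) = E₀`.
In use, `I` is `[0, T)` or `[0, ∞)`; the values of `V`, `E` at times outside `I` play no role
(the time derivative at `t = 0` is one-sided, and analyticity is relative to `I × ℝ`). -/
structure IsSolution (ν : ℝ → ℝ) (I : Set ℝ) (V₀ E₀ : ℝ → ℝ) (V E : ℝ → ℝ → ℝ) : Prop where
  analytic_V : AnalyticOn ℝ (fun p : ℝ × ℝ => V p.1 p.2) (I ×ˢ univ)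
  analytic_E : AnalyticOn ℝ (fun p : ℝ × ℝ => E p.1 p.2) (I ×ˢ univ)
  density_pos : ∀ t ∈ I, ∀ x, 0 < density E t x
  eq_V : ∀ t ∈ I, ∀ x, derivWithin (fun s => V s x) I t + V t x * deriv (V t) x
    = -E t x - ν (density E t x) * V t x
  eq_E : ∀ t ∈ I, ∀ x, derivWithin (fun s => E s x) I t + V t x * deriv (E t) x = V t x
  init_V : ∀ x, V 0 x = V₀ x
  init_E : ∀ x, E 0 x = E₀ x

/-- `W` is affine in the space variable at all times in `I`: `W(t,x) = c(t) x + d(t)`. -/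
def IsAffineOn (I : Set ℝ) (W : ℝ → ℝ → ℝ) : Prop :=
  ∃ c d : ℝ → ℝ, ∀ t ∈ I, ∀ x, W t x = c t * x + d t

/-- On the time set `I`, `(V, E)` is the only analytic solution of the Cauchy problem, in the sense
that every analytic solution on some `[0, T')` agrees with it at the common times. -/
def IsUniqueOn (ν : ℝ → ℝ) (I : Set ℝ) (V₀ E₀ : ℝ → ℝ) (V E : ℝ → ℝ → ℝ) : Prop :=
  ∀ T' : ℝ, 0 < T' → ∀ V' E' : ℝ → ℝ → ℝ, IsSolution ν (Ico 0 T') V₀ E₀ V' E' →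
    ∀ t ∈ I ∩ Ico 0 T', ∀ x, V' t x = V t x ∧ E' t x = E t x

end ColdPlasma

/-! For affine data the gradients obey a closed ODE. With `n = 1 - E_x`, `u = 1 / n` and `w = V_x /
n`, the system gives `u' = w`, `w' = 1 - u - ν(1/u) w`: an oscillator about `u = 1` with nonnegative
damping. The energy `(u - 1)² + w²` does not grow, so `w` stays bounded, `u` is bounded above, and
the gradients `w / u` and `1 - 1 / u` can blow up only if `u` approaches `0`.

Whether it does is read off the Liénard variable `w + Φ(u)`, where `Φ'(u) = ν(1/u)`: its derivative
is `1 - u`, free of damping. Here `Φ(u) = -ε ∫_{η₀}^{1/u} f(η)/η² dη`, so divergence of the integral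
means `Φ → -∞` at `u = 0`, and convergence means that `Φ` is bounded below. In the first case the
Liénard variable is bounded below (`le_lienard`); as `w` is bounded, so is `Φ(u)` from below, and
`u` stays away from `0`. In the second case `w + Φ(u)` grows at most at unit rate (`lienard_le`), so
a very negative `w(0)` keeps `w` negative and drives `u` to `0` before time `1`.

Solutions of the ODE are analytic by the implicit function theorem applied to a rescaled integral
equation (`analyticAt_zero_of_hasDerivAt`). Uniqueness for the PDE is of Cauchy–Kovalevskaya type:
if two solutions agree to order `k` in `t` at `t = 0`, so do their `x`-derivatives, and the
equations raise the order to `k + 1`. Agreement to all orders and the identity theorem finish the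
argument (`local_unique`, `IsSolution.eq_of_subset`). -/

open Set Filter Topology MeasureTheory

/-! ### Analyticity of solutions of analytic differential equations -/

/-- The formal multilinear series acting pointwise on continuous functions. -/
noncomputable def FormalMultilinearSeries.pointwise {E G : Type*} [NormedAddCommGroup E]
    [NormedSpace ℝ E] [NormedAddCommGroup G] [NormedSpace ℝ G] (K : Type*) [TopologicalSpace K]
    [CompactSpace K] (p : FormalMultilinearSeries ℝ E G) :
    FormalMultilinearSeries ℝ C(K, E) C(K, G) := fun n =>
  MultilinearMap.mkContinuous
    { toFun := fun v => ⟨fun s => p n (fun i => v i s), by fun_prop⟩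
      map_update_add' := by
        intro _ v i x y
        ext s
        have h : ∀ z : C(K, E), (fun j => (Function.update v i z) j s)
            = Function.update (fun j => v j s) i (z s) := by
          intro z; ext j; by_cases hj : j = i
          · subst hj; simp
          · simp [hj]
        simp only [ContinuousMap.coe_mk, ContinuousMap.add_apply, h]
        convert (p n).map_update_add (fun j => v j s) i (x s) (y s)
      map_update_smul' := by
        intro _ v i c x
        ext s
        have h : ∀ z : C(K, E), (fun j => (Function.update v i z) j s)
            = Function.update (fun j => v j s) i (z s) := by
          intro z; ext j; by_cases hj : j = i
          · subst hj; simp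
          · simp [hj]
        simp only [ContinuousMap.coe_mk, ContinuousMap.smul_apply, h]
        convert (p n).map_update_smul (fun j => v j s) i c (x s) }
    ‖p n‖ (by
      intro v
      rw [ContinuousMap.norm_le _ (by positivity)]
      intro s
      refine ((p n).le_opNorm _).trans ?_
      gcongr with i
      exact (v i).norm_coe_le_norm s)

/-- With sup norms on both sides, pointwise action does not increase the norm of any coefficient. -/
theorem FormalMultilinearSeries.radius_le_radius_pointwise {E G : Type*} [NormedAddCommGroup E]
    [NormedSpace ℝ E] [NormedAddCommGroup G] [NormedSpace ℝ G] (K : Type*) [TopologicalSpace K]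
    [CompactSpace K] (p : FormalMultilinearSeries ℝ E G) :
    p.radius ≤ (p.pointwise K).radius :=
  FormalMultilinearSeries.radius_le_of_le fun _ =>
    MultilinearMap.mkContinuous_norm_le _ (norm_nonneg _) _

/-- Superposition with an analytic map is analytic on continuous functions, near a constant. -/
theorem AnalyticAt.exists_analyticAt_superposition {E G : Type*} [NormedAddCommGroup E]
    [NormedSpace ℝ E] [NormedAddCommGroup G] [NormedSpace ℝ G] [CompleteSpace G]
    (K : Type*) [TopologicalSpace K] [CompactSpace K] {F : E → G} {y₀ : E}
    (hF : AnalyticAt ℝ F y₀) :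
    ∃ N : C(K, E) → C(K, G), AnalyticAt ℝ N (ContinuousMap.const K y₀) ∧
      ∀ᶠ u in 𝓝 (ContinuousMap.const K y₀), ∀ s, N u s = F (u s) := by
  obtain ⟨p, R, hp⟩ := hF
  have hr : 0 < (p.pointwise K).radius :=
    (hp.r_pos.trans_le hp.r_le).trans_le (p.radius_le_radius_pointwise K)
  have hB := (p.pointwise K).hasFPowerSeriesOnBall hr
  refine ⟨fun u => (p.pointwise K).sum (u - ContinuousMap.const K y₀), ?_, ?_⟩
  · have := hB.comp_sub (ContinuousMap.const K y₀)
    rw [zero_add] at this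
    exact this.analyticAt
  · filter_upwards [Metric.eball_mem_nhds (ContinuousMap.const K y₀) hp.r_pos] with u hu s
    set v := u - ContinuousMap.const K y₀ with hv
    have hvn : v ∈ Metric.eball (0 : C(K, E)) R := by
      rw [Metric.mem_eball, edist_eq_enorm_sub] at hu ⊢
      simpa [hv] using hu
    have hvs : v s ∈ Metric.eball (0 : E) R := by
      rw [Metric.mem_eball, edist_eq_enorm_sub, sub_zero] at hvn ⊢
      refine lt_of_le_of_lt ?_ hvn
      rw [← ofReal_norm, ← ofReal_norm]
      exact ENNReal.ofReal_le_ofReal (v.norm_coe_le_norm s)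
    have h1 := (p.pointwise K).hasSum (x := v) (Metric.eball_subset_eball
      (hp.r_le.trans (p.radius_le_radius_pointwise K)) hvn)
    have h2 := hp.hasSum hvs
    -- Evaluation at `s` is continuous and linear, so it carries the series in `C(K, G)` to the
    -- series of `F` at `u s`.
    have h3 := h1.mapL (ContinuousMap.evalCLM ℝ s)
    have h4 : y₀ + v s = u s := by simp [hv]
    rw [h4] at h2
    exact h3.unique h2

/-- Integration from `0` as an operator on continuous functions on the unit interval. -/
noncomputable def ContinuousMap.primitiveCLM (E : Type*) [NormedAddCommGroup E] [NormedSpace ℝ E] :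
    C(Icc (0 : ℝ) 1, E) →L[ℝ] C(Icc (0 : ℝ) 1, E) :=
  LinearMap.mkContinuous
    { toFun := fun u => ⟨fun s => ∫ r in (0 : ℝ)..s, u (projIcc 0 1 zero_le_one r), by
        have hc : Continuous fun r => u (projIcc 0 1 zero_le_one r) := by fun_prop
        exact (intervalIntegral.continuous_primitive
          (fun a b => hc.intervalIntegrable a b) 0).comp continuous_subtype_val⟩
      map_add' := by
        intro u v
        ext s
        have hc : ∀ u : C(Icc (0 : ℝ) 1, E),
          Continuous fun r => u (projIcc 0 1 zero_le_one r) := by intro u; fun_prop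
        simp [intervalIntegral.integral_add ((hc u).intervalIntegrable _ _)
          ((hc v).intervalIntegrable _ _)]
      map_smul' := by
        intro c u
        ext s
        simp }
    1 (by
      intro u
      rw [one_mul, ContinuousMap.norm_le _ (norm_nonneg _)]
      intro s
      have := intervalIntegral.norm_integral_le_of_norm_le_const (a := 0) (b := (s : ℝ))
        (f := fun r => u (projIcc 0 1 zero_le_one r)) (C := ‖u‖)
        (fun r _ => u.norm_coe_le_norm _)
      refine this.trans ?_
      rw [sub_zero, abs_of_nonneg s.2.1]
      exact mul_le_of_le_one_right (norm_nonneg _) s.2.2)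

/-- The case `t₀ = 0` of `analyticAt_of_hasDerivAt`. -/
theorem analyticAt_zero_of_hasDerivAt {E : Type*} [NormedAddCommGroup E] [NormedSpace ℝ E]
    [CompleteSpace E] {F : E → E} {y : ℝ → E} (hF : AnalyticAt ℝ F (y 0))
    (hy : ∀ᶠ t in 𝓝 0, HasDerivAt y (F (y t)) t) : AnalyticAt ℝ y 0 := by
  let I := Icc (0 : ℝ) 1
  obtain ⟨N, hN, hNF⟩ := hF.exists_analyticAt_superposition I
  set c : C(I, E) := ContinuousMap.const I (y 0) with hc
  let J := ContinuousMap.primitiveCLM E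
  -- Near `(0, c)`, the zeros of `G` are the solutions of `u(s) = y 0 + t ∫₀ˢ F(u)`, satisfied by
  -- the rescaled trajectory `u(s) = y(ts)`. Time has become a parameter, on which the implicit
  -- function depends analytically.
  let G : ℝ × C(I, E) → C(I, E) := fun p => p.2 - c - p.1 • J (N p.2)
  have hGa : AnalyticAt ℝ G (0, c) := by
    have h1 : AnalyticAt ℝ (fun p : ℝ × C(I, E) => N p.2) (0, c) :=
      AnalyticAt.comp (f := Prod.snd) (x := ((0 : ℝ), c)) hN analyticAt_snd
    have h2 : AnalyticAt ℝ (fun p : ℝ × C(I, E) => J (N p.2)) (0, c) := (J.analyticAt _).comp h1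
    exact (analyticAt_snd.sub analyticAt_const).sub (analyticAt_fst.smul h2)
  have hG : ContDiffAt ℝ ⊤ G (0, c) := hGa.contDiffAt
  -- At `t = 0` the map is `u ↦ u - c`, so its derivative in `u` is the identity.
  have hinr : fderiv ℝ G (0, c) ∘L .inr ℝ ℝ C(I, E) = .id ℝ _ := by
    have h1 : HasFDerivAt (fun u : C(I, E) => G (0, u)) (fderiv ℝ G (0, c) ∘L .inr ℝ ℝ C(I, E)) c :=
      HasFDerivAt.comp (f := fun u : C(I, E) => ((0 : ℝ), u)) (x := c) (g := G)
        hGa.differentiableAt.hasFDerivAt (hasFDerivAt_prodMk_right 0 c)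
    have h2 : HasFDerivAt (fun u : C(I, E) => G (0, u)) (.id ℝ C(I, E)) c := by
      simpa [G] using (hasFDerivAt_id c).sub_const c
    exact h1.unique h2
  have hinv : (fderiv ℝ G (0, c) ∘L .inr ℝ ℝ C(I, E)).IsInvertible := by
    rw [hinr]; exact ContinuousLinearMap.isInvertible_equiv (f := .refl ℝ _)
  have htop : (⊤ : WithTop ℕ∞) ≠ 0 := by simp
  set ψ := hG.implicitFunction htop hinv with hψ
  have hψa : AnalyticAt ℝ ψ 0 := by
    have := hG.contDiffAt_implicitFunction htop hinv
    exact this.analyticAt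
  have hev := hG.eventually_apply_eq_iff_implicitFunction htop hinv
  have hG0 : G (0, c) = 0 := by simp [G]
  obtain ⟨ρ, hρ, hball⟩ := Metric.eventually_nhds_iff_ball.1
    (hev.and (continuousAt_snd.eventually hNF))
  have hcont : ContinuousAt y 0 := hy.self_of_nhds.continuousAt
  obtain ⟨δ, hδ, hyδ⟩ := Metric.eventually_nhds_iff_ball.1
    (hy.and (hcont.eventually (Metric.ball_mem_nhds (y 0) (half_pos hρ))))
  -- The rescaled trajectory is the implicit solution, and its value at `s = 1` is `y t`.
  have hkey : (fun t => ψ t ⟨1, zero_le_one, le_rfl⟩) =ᶠ[𝓝 0] y := by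
    filter_upwards [Metric.ball_mem_nhds (0 : ℝ) (lt_min hδ hρ)] with t ht
    have ht' : |t| < δ ∧ |t| < ρ := by simpa using ht
    have hmem : ∀ r ∈ I, t * r ∈ Metric.ball (0 : ℝ) δ := by
      intro r hr
      rw [mem_ball_zero_iff, Real.norm_eq_abs, abs_mul, abs_of_nonneg hr.1]
      exact (mul_le_of_le_one_right (abs_nonneg _) hr.2).trans_lt ht'.1
    let u : C(I, E) := ⟨fun r => y (t * r), by
      rw [continuous_iff_continuousAt]
      intro r
      exact ContinuousAt.comp (f := fun r : I => t * (r : ℝ)) (x := r)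
        (hyδ _ (hmem r r.2)).1.continuousAt (by fun_prop)⟩
    have hu : dist u c ≤ ρ / 2 := by
      rw [ContinuousMap.dist_le (by positivity)]
      intro r
      exact (Metric.mem_ball.1 (hyδ _ (hmem r r.2)).2).le
    have htu : (t, u) ∈ Metric.ball ((0 : ℝ), c) ρ := by
      rw [Metric.mem_ball, Prod.dist_eq, max_lt_iff]
      refine ⟨by simpa using ht'.2, lt_of_le_of_lt hu (half_lt_self hρ)⟩
    obtain ⟨h1, h2⟩ := hball _ htu
    have hGu : G (t, u) = G (0, c) := by
      rw [hG0]
      ext s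
      have hJ : t • J (N u) s = y (t * s) - y (t * 0) := by
        have hd : ∀ r ∈ uIcc (0 : ℝ) s, HasDerivAt (fun r => y (t * r)) (t • F (y (t * r))) r := by
          intro r hr
          rw [uIcc_of_le s.2.1] at hr
          have h3 := (hyδ _ (hmem r ⟨hr.1, hr.2.trans s.2.2⟩)).1
          have h4 : HasDerivAt (fun r => t * r) t r := by
            simpa using (hasDerivAt_id r).const_mul t
          exact h3.scomp r h4
        have he : ∀ r ∈ uIcc (0 : ℝ) s, t • F (y (t * r)) = t • N u (projIcc 0 1 zero_le_one r) := by
          intro r hr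
          rw [uIcc_of_le s.2.1] at hr
          rw [h2, projIcc_of_mem zero_le_one ⟨hr.1, hr.2.trans s.2.2⟩]
          rfl
        have hi : IntervalIntegrable (fun r => t • F (y (t * r))) volume 0 s := by
          have : Continuous fun r => t • N u (projIcc 0 1 zero_le_one r) := by fun_prop
          exact (this.intervalIntegrable 0 s).congr
            fun r hr => (he r (uIoc_subset_uIcc hr)).symm
        rw [← intervalIntegral.integral_eq_sub_of_hasDerivAt hd hi,
          intervalIntegral.integral_congr he, intervalIntegral.integral_smul]
        rfl
      change u s - c s - t • J (N u) s = 0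
      rw [hJ]
      simp [u, hc]
    have h5 := h1.1 hGu
    change ψ t _ = y t
    change ψ t = u at h5
    rw [h5]
    simp [u]
  have : AnalyticAt ℝ (fun t => ContinuousMap.evalCLM ℝ (⟨1, zero_le_one, le_rfl⟩ : I) (ψ t)) 0 :=
    ((ContinuousMap.evalCLM ℝ (⟨1, zero_le_one, le_rfl⟩ : I) :
      C(I, E) →L[ℝ] E).analyticAt (ψ 0)).comp hψa
  exact this.congr hkey

/-- Solutions of an autonomous analytic differential equation are analytic. -/
theorem analyticAt_of_hasDerivAt {E : Type*} [NormedAddCommGroup E] [NormedSpace ℝ E]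
    [CompleteSpace E] {F : E → E} {y : ℝ → E} {t₀ : ℝ} (hF : AnalyticAt ℝ F (y t₀))
    (hy : ∀ᶠ t in 𝓝 t₀, HasDerivAt y (F (y t)) t) : AnalyticAt ℝ y t₀ := by
  have h0 : AnalyticAt ℝ (fun t => y (t + t₀)) 0 := by
    refine analyticAt_zero_of_hasDerivAt (F := F) (by simpa using hF) ?_
    have ht : Tendsto (fun t : ℝ => t + t₀) (𝓝 0) (𝓝 t₀) := by
      have : ContinuousAt (fun t : ℝ => t + t₀) 0 := by fun_prop
      simpa [ContinuousAt] using this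
    filter_upwards [ht.eventually hy] with t h
    exact HasDerivAt.comp_add_const t t₀ h
  have h1 : AnalyticAt ℝ (fun t : ℝ => t - t₀) t₀ := analyticAt_id.sub analyticAt_const
  have h2 : AnalyticAt ℝ ((fun t => y (t + t₀)) ∘ fun t => t - t₀) t₀ :=
    AnalyticAt.comp (by simpa using h0) h1
  simpa [Function.comp_def] using h2

/-! ### Trajectories: uniqueness, continuation, maximal solutions -/

/-- `y` solves `y' = F y` at the times in `I`, with values in `Ω`. -/
def IsTrajectoryOn {E : Type*} [NormedAddCommGroup E] [NormedSpace ℝ E] (F : E → E) (Ω : Set E)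
    (I : Set ℝ) (y : ℝ → E) : Prop :=
  ∀ t ∈ I, y t ∈ Ω ∧ HasDerivAt y (F (y t)) t

namespace IsTrajectoryOn

variable {E : Type*} [NormedAddCommGroup E] [NormedSpace ℝ E] {F : E → E} {Ω : Set E}
  {I J : Set ℝ} {y z : ℝ → E}

theorem mono (hy : IsTrajectoryOn F Ω I y) (h : J ⊆ I) : IsTrajectoryOn F Ω J y :=
  fun t ht => hy t (h ht)

theorem congr (hy : IsTrajectoryOn F Ω I y) (hI : IsOpen I) (h : EqOn z y I) :
    IsTrajectoryOn F Ω I z := by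
  intro t ht
  have he : z =ᶠ[𝓝 t] y := h.eventuallyEq_of_mem (hI.mem_nhds ht)
  rw [h ht]
  exact ⟨(hy t ht).1, (hy t ht).2.congr_of_eventuallyEq he⟩

theorem eventually_hasDerivAt (hy : IsTrajectoryOn F Ω I y) (hI : IsOpen I) {t : ℝ} (ht : t ∈ I) :
    ∀ᶠ s in 𝓝 t, HasDerivAt y (F (y s)) s := by
  filter_upwards [hI.mem_nhds ht] with s hs using (hy s hs).2

variable [CompleteSpace E]

theorem analyticOnNhd (hy : IsTrajectoryOn F Ω I y) (hI : IsOpen I) (hF : AnalyticOnNhd ℝ F Ω) :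
    AnalyticOnNhd ℝ y I :=
  fun t ht => analyticAt_of_hasDerivAt (hF _ (hy t ht).1) (hy.eventually_hasDerivAt hI ht)

/-- The Lipschitz uniqueness theorem is needed only near `t₀`; analyticity of both trajectories
spreads the equality over `I`. -/
theorem eqOn (hy : IsTrajectoryOn F Ω I y) (hz : IsTrajectoryOn F Ω I z) (hI : IsOpen I)
    (hIc : IsPreconnected I) (hF : AnalyticOnNhd ℝ F Ω) {t₀ : ℝ} (ht₀ : t₀ ∈ I)
    (h : y t₀ = z t₀) : EqOn y z I := by
  refine (hy.analyticOnNhd hI hF).eqOn_of_preconnected_of_eventuallyEq (hz.analyticOnNhd hI hF)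
    hIc ht₀ ?_
  obtain ⟨K, s, hs, hl⟩ := ((hF _ (hy t₀ ht₀).1).contDiffAt (n := 1)).exists_lipschitzOnWith
  refine ODE_solution_unique_of_eventually (v := fun _ => F) (s := fun _ => s) (K := K)
    (.of_forall fun _ => hl) ?_ ?_ h
  · exact (hy.eventually_hasDerivAt hI ht₀).and ((hy t₀ ht₀).2.continuousAt.eventually hs)
  · rw [h] at hs
    exact (hz.eventually_hasDerivAt hI ht₀).and ((hz t₀ ht₀).2.continuousAt.eventually hs)

theorem exists_local (hF : AnalyticOnNhd ℝ F Ω) (hΩ : IsOpen Ω) {y₀ : E} (hy₀ : y₀ ∈ Ω) (t₀ : ℝ) :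
    ∃ δ > 0, ∃ y : ℝ → E, y t₀ = y₀ ∧ IsTrajectoryOn F Ω (Ioo (t₀ - δ) (t₀ + δ)) y := by
  obtain ⟨y, h0, ε, hε, hy⟩ := ((hF _ hy₀).contDiffAt
    (n := 1)).exists_forall_mem_closedBall_exists_eq_forall_mem_Ioo_hasDerivAt₀ t₀
  have hc : ContinuousAt y t₀ := (hy t₀ ⟨by linarith, by linarith⟩).continuousAt
  have hm : ∀ᶠ t in 𝓝 t₀, y t ∈ Ω := hc.eventually (hΩ.mem_nhds (by rwa [h0]))
  obtain ⟨δ, hδ, h⟩ := Metric.eventually_nhds_iff_ball.1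
    (hm.and (Ioo_mem_nhds (by linarith : t₀ - ε < t₀) (by linarith : t₀ < t₀ + ε)))
  rw [Real.ball_eq_Ioo] at h
  exact ⟨δ, hδ, y, h0, fun t ht => ⟨(h t ht).1, hy t (h t ht).2⟩⟩

/-- A trajectory that stays in a compact subset of the domain has a limit at a finite end time. -/
theorem exists_tendsto_left {a T : ℝ} (haT : a < T) (hy : IsTrajectoryOn F Ω (Ico a T) y)
    {K : Set E} (hK : IsCompact K) (hFK : ContinuousOn F K) (hyK : ∀ t ∈ Ico a T, y t ∈ K) :
    ∃ p ∈ K, Tendsto y (𝓝[<] T) (𝓝 p) := by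
  obtain ⟨C, hC⟩ := hK.exists_bound_of_continuousOn hFK
  have hlip : LipschitzOnWith C.toNNReal y (Ico a T) := by
    refine (convex_Ico a T).lipschitzOnWith_of_nnnorm_hasDerivWithin_le
      (fun t ht => (hy t ht).2.hasDerivWithinAt) fun t ht => ?_
    rw [← NNReal.coe_le_coe, coe_nnnorm]
    exact (hC _ (hyK t ht)).trans (Real.le_coe_toNNReal C)
  have hle : 𝓝[<] T ≤ 𝓟 (Ico a T) := le_principal_iff.2 (Ico_mem_nhdsLT haT)
  have hcau : Cauchy (map y (𝓝[<] T)) :=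
    (cauchy_nhds.mono nhdsWithin_le_nhds).map_of_le hlip.uniformContinuousOn hle
  obtain ⟨p, hp⟩ := CompleteSpace.complete hcau
  refine ⟨p, hK.isClosed.mem_of_tendsto hp ?_, hp⟩
  filter_upwards [Ico_mem_nhdsLT haT] with t ht using hyK t ht

/-- The trajectory has a limit `p ∈ Ω` at `T`, and a local solution through `p` is glued on. At `T`
itself the left derivative is the limit of the derivatives, the right one comes from the local
solution, and both equal `F p`. -/
theorem exists_extension (hF : AnalyticOnNhd ℝ F Ω) (hΩ : IsOpen Ω) {a b T : ℝ} (hab : a < b)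
    (hbT : b < T) (hy : IsTrajectoryOn F Ω (Ioo a T) y) {K : Set E} (hK : IsCompact K)
    (hKΩ : K ⊆ Ω) (hyK : ∀ t ∈ Ico b T, y t ∈ K) :
    ∃ T' > T, ∃ z, EqOn z y (Ioo a T) ∧ IsTrajectoryOn F Ω (Ioo a T') z := by
  have hyb : IsTrajectoryOn F Ω (Ico b T) y := hy.mono fun t ht => ⟨hab.trans_le ht.1, ht.2⟩
  obtain ⟨p, hpK, hp⟩ := hyb.exists_tendsto_left hbT hK (hF.continuousOn.mono hKΩ) hyK
  obtain ⟨δ, hδ, α, hα0, hα⟩ := exists_local hF hΩ (hKΩ hpK) T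
  let z : ℝ → E := fun t => if t < T then y t else α t
  have hzy : EqOn z y (Iio T) := fun t ht => if_pos ht
  have hzα : EqOn z α (Ici T) := fun t ht => if_neg (not_lt.2 ht)
  have hzT : z T = p := by rw [hzα self_mem_Ici, hα0]
  refine ⟨T + δ, by linarith, z, fun t ht => hzy ht.2, fun t ht => ?_⟩
  rcases lt_trichotomy t T with h | h | h
  · rw [hzy h]
    refine ⟨(hy t ⟨ht.1, h⟩).1, (hy t ⟨ht.1, h⟩).2.congr_of_eventuallyEq ?_⟩
    exact hzy.eventuallyEq_of_mem (Iio_mem_nhds h)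
  · subst h
    rw [hzT]
    refine ⟨hKΩ hpK, ?_⟩
    have hzp : Tendsto z (𝓝[<] t) (𝓝 p) :=
      hp.congr' (hzy.symm.eventuallyEq_of_mem self_mem_nhdsWithin)
    have hzd : ∀ s ∈ Ioo a t, HasDerivAt z (F (y s)) s := fun s hs =>
      (hy s hs).2.congr_of_eventuallyEq (hzy.eventuallyEq_of_mem (Iio_mem_nhds hs.2))
    have hmem : Ioo a t ∈ 𝓝[<] t := Ioo_mem_nhdsLT ht.1
    have hl : HasDerivWithinAt z (F p) (Iic t) t := by
      refine hasDerivWithinAt_Iic_of_tendsto_deriv (s := Ioo a t)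
        (fun s hs => (hzd s hs).differentiableAt.differentiableWithinAt) ?_ hmem ?_
      · rw [ContinuousWithinAt, hzT]
        exact hzp.mono_left (nhdsWithin_mono _ Ioo_subset_Iio_self)
      · have h1 : Tendsto (fun s => F (y s)) (𝓝[<] t) (𝓝 (F p)) :=
          (hF p (hKΩ hpK)).continuousAt.tendsto.comp hp
        refine h1.congr' ?_
        filter_upwards [hmem] with s hs using (hzd s hs).deriv.symm
    have hr : HasDerivWithinAt z (F p) (Ici t) t := by
      have := (hα t ⟨by linarith, by linarith⟩).2.hasDerivWithinAt (s := Ici t)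
      rw [hα0] at this
      exact this.congr hzα (hzα self_mem_Ici)
    have := hl.union hr
    rwa [Iic_union_Ici, hasDerivWithinAt_univ] at this
  · rw [hzα h.le]
    have hm : t ∈ Ioo (T - δ) (T + δ) := ⟨by linarith, ht.2⟩
    refine ⟨(hα t hm).1, (hα t hm).2.congr_of_eventuallyEq ?_⟩
    filter_upwards [Ioi_mem_nhds h] with s hs using hzα (mem_Ioi.1 hs).le

/-- Maximal solution of an analytic differential equation: it is global, or it leaves every compact
subset of the domain. -/
theorem exists_maximal (hF : AnalyticOnNhd ℝ F Ω) (hΩ : IsOpen Ω) {y₀ : E} (hy₀ : y₀ ∈ Ω) :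
    ∃ δ > 0, ∃ y : ℝ → E, y 0 = y₀ ∧ (IsTrajectoryOn F Ω (Ioi (-δ)) y ∨
      ∃ T > 0, IsTrajectoryOn F Ω (Ioo (-δ) T) y ∧
        ∀ K ⊆ Ω, IsCompact K → ∃ t ∈ Ico 0 T, y t ∉ K) := by
  classical
  obtain ⟨δ, hδ, x, hx0, hx⟩ := exists_local hF hΩ hy₀ 0
  rw [zero_sub, zero_add] at hx
  refine ⟨δ, hδ, ?_⟩
  let S : Set ℝ := {T | 0 < T ∧ ∃ y : ℝ → E, y 0 = y₀ ∧ IsTrajectoryOn F Ω (Ioo (-δ) T) y}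
  have hδS : δ ∈ S := ⟨hδ, x, hx0, hx⟩
  choose Y hY0 hY using fun (T : ℝ) (hT : T ∈ S) => hT.2
  -- At time `t` any solution living past `t` is used; by uniqueness the choice does not matter. The
  -- default `0` occurs only past every lifetime.
  let y : ℝ → E := fun t => if h : ∃ T ∈ S, t < T then Y h.choose h.choose_spec.1 t else 0
  have heq : ∀ T (hT : T ∈ S), EqOn y (Y T hT) (Ioo (-δ) T) := by
    intro T hT t ht
    have h : ∃ T ∈ S, t < T := ⟨T, hT, ht.2⟩
    have h1 : y t = Y h.choose h.choose_spec.1 t := dif_pos h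
    rw [h1]
    set T' := h.choose
    have hT' : T' ∈ S := h.choose_spec.1
    have ht' : t < T' := h.choose_spec.2
    have hmin : 0 < min T T' := lt_min hT.1 hT'.1
    refine IsTrajectoryOn.eqOn (I := Ioo (-δ) (min T T'))
      ((hY T' hT').mono (Ioo_subset_Ioo_right (min_le_right _ _)))
      ((hY T hT).mono (Ioo_subset_Ioo_right (min_le_left _ _))) isOpen_Ioo isPreconnected_Ioo hF
      (t₀ := 0) ⟨by linarith, hmin⟩ ?_ ⟨ht.1, lt_min ht.2 ht'⟩
    rw [hY0, hY0]
  have htraj : ∀ T ∈ S, IsTrajectoryOn F Ω (Ioo (-δ) T) y := fun T hT =>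
    (hY T hT).congr isOpen_Ioo (heq T hT)
  have hy0 : y 0 = y₀ := by rw [heq δ hδS ⟨by linarith, hδ⟩, hY0]
  refine ⟨y, hy0, ?_⟩
  by_cases hb : BddAbove S
  · right
    set T := sSup S
    have hδT : δ ≤ T := le_csSup hb hδS
    have hyT : IsTrajectoryOn F Ω (Ioo (-δ) T) y := by
      intro t ht
      obtain ⟨T₁, hT₁, h⟩ := exists_lt_of_lt_csSup ⟨δ, hδS⟩ ht.2
      exact htraj T₁ hT₁ t ⟨ht.1, h⟩
    refine ⟨T, by linarith, hyT, fun K hKΩ hK => ?_⟩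
    by_contra! hcon
    obtain ⟨T', hT', z, hzy, hz⟩ := hyT.exists_extension hF hΩ (b := 0) (by linarith)
      (by linarith) hK hKΩ hcon
    have : T' ∈ S := ⟨by linarith, z, by rw [hzy ⟨by linarith, by linarith⟩, hy0], hz⟩
    exact absurd (le_csSup hb this) (not_le.2 hT')
  · left
    intro t ht
    obtain ⟨T₁, hT₁, h⟩ := not_bddAbove_iff.1 hb t
    exact htraj T₁ hT₁ t ⟨ht, h⟩

end IsTrajectoryOn

/-! ### Partial derivatives and order of vanishing in time -/

/-- The derivative of a function on the plane with respect to its first variable. -/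
noncomputable def partialFst (F : ℝ × ℝ → ℝ) : ℝ × ℝ → ℝ := fun p => fderiv ℝ F p (1, 0)

/-- The derivative of a function on the plane with respect to its second variable. -/
noncomputable def partialSnd (F : ℝ × ℝ → ℝ) : ℝ × ℝ → ℝ := fun p => fderiv ℝ F p (0, 1)

section Partial

variable {F G : ℝ × ℝ → ℝ} {U : Set (ℝ × ℝ)}

theorem AnalyticOnNhd.partialFst (hF : AnalyticOnNhd ℝ F U) : AnalyticOnNhd ℝ (partialFst F) U :=
  fun p hp => ((ContinuousLinearMap.apply ℝ ℝ ((1 : ℝ), (0 : ℝ))).analyticAt _).comp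
    (hF p hp).fderiv

theorem AnalyticOnNhd.partialSnd (hF : AnalyticOnNhd ℝ F U) : AnalyticOnNhd ℝ (partialSnd F) U :=
  fun p hp => ((ContinuousLinearMap.apply ℝ ℝ ((0 : ℝ), (1 : ℝ))).analyticAt _).comp
    (hF p hp).fderiv

theorem AnalyticOnNhd.iterate_partialFst (hF : AnalyticOnNhd ℝ F U) (j : ℕ) :
    AnalyticOnNhd ℝ (_root_.partialFst^[j] F) U := by
  induction j with
  | zero => exact hF
  | succ j ih => rw [Function.iterate_succ_apply']; exact ih.partialFst

theorem AnalyticAt.hasDerivAt_partialFst {p : ℝ × ℝ} (hF : AnalyticAt ℝ F p) :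
    HasDerivAt (fun t => F (t, p.2)) (partialFst F p) p.1 := by
  have h1 : HasFDerivAt F (fderiv ℝ F p) (p.1, p.2) := hF.differentiableAt.hasFDerivAt
  have h2 : HasDerivAt (fun t : ℝ => (t, p.2)) ((1 : ℝ), (0 : ℝ)) p.1 :=
    (hasDerivAt_id p.1).prodMk (hasDerivAt_const _ _)
  exact h1.comp_hasDerivAt p.1 h2

theorem AnalyticAt.hasDerivAt_partialSnd {p : ℝ × ℝ} (hF : AnalyticAt ℝ F p) :
    HasDerivAt (fun x => F (p.1, x)) (partialSnd F p) p.2 := by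
  have h1 : HasFDerivAt F (fderiv ℝ F p) (p.1, p.2) := hF.differentiableAt.hasFDerivAt
  have h2 : HasDerivAt (fun x : ℝ => (p.1, x)) ((0 : ℝ), (1 : ℝ)) p.2 :=
    (hasDerivAt_const _ _).prodMk (hasDerivAt_id p.2)
  exact h1.comp_hasDerivAt p.2 h2

theorem AnalyticAt.fst_slice {p : ℝ × ℝ} (hF : AnalyticAt ℝ F p) :
    AnalyticAt ℝ (fun t => F (t, p.2)) p.1 :=
  AnalyticAt.comp (f := fun t : ℝ => (t, p.2)) (x := p.1) hF (analyticAt_id.prod analyticAt_const)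

theorem partialFst_partialSnd_comm {p : ℝ × ℝ} (hF : AnalyticAt ℝ F p) :
    partialFst (partialSnd F) p = partialSnd (partialFst F) p := by
  have hd : DifferentiableAt ℝ (fderiv ℝ F) p := hF.fderiv.differentiableAt
  have h : ∀ v w : ℝ × ℝ, fderiv ℝ (fun q => fderiv ℝ F q v) p w = fderiv ℝ (fderiv ℝ F) p w v := by
    intro v w
    rw [fderiv_clm_apply hd (differentiableAt_const v)]
    simp
  have hs : IsSymmSndFDerivAt ℝ F p := hF.contDiffAt.isSymmSndFDerivAt_of_omega
  unfold partialFst partialSnd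
  rw [h, h]
  exact hs _ _

theorem iterate_partialFst_partialSnd (hU : IsOpen U) (hF : AnalyticOnNhd ℝ F U) (j : ℕ) :
    EqOn (partialFst^[j] (partialSnd F)) (partialSnd (partialFst^[j] F)) U := by
  induction j with
  | zero => exact fun _ _ => rfl
  | succ j ih =>
    intro p hp
    rw [Function.iterate_succ_apply', Function.iterate_succ_apply',
      ← partialFst_partialSnd_comm (hF.iterate_partialFst j p hp)]
    have := (ih.eventuallyEq_of_mem (hU.mem_nhds hp)).fderiv_eq (𝕜 := ℝ)
    simp only [partialFst]
    exact congrArg (fun L : ℝ × ℝ →L[ℝ] ℝ => L (1, 0)) this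

theorem iteratedDeriv_fst_slice (hU : IsOpen U) (hF : AnalyticOnNhd ℝ F U) (j : ℕ) {p : ℝ × ℝ}
    (hp : p ∈ U) : iteratedDeriv j (fun t => F (t, p.2)) p.1 = partialFst^[j] F p := by
  induction j generalizing p with
  | zero => simp
  | succ j ih =>
    rw [iteratedDeriv_succ, Function.iterate_succ_apply']
    have h : iteratedDeriv j (fun t => F (t, p.2)) =ᶠ[𝓝 p.1]
        fun t => partialFst^[j] F (t, p.2) := by
      have hc : ContinuousAt (fun t : ℝ => (t, p.2)) p.1 := by fun_prop
      filter_upwards [hc.preimage_mem_nhds (hU.mem_nhds hp)] with t ht using ih ht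
    rw [h.deriv_eq]
    exact ((hF.iterate_partialFst j p hp).hasDerivAt_partialFst).deriv

/-- Turns the order in `t` into equations on the line `t = 0`, which can then be differentiated in
`x`. -/
theorem natCast_le_analyticOrderAt_slice_iff (hU : IsOpen U) (hF : AnalyticOnNhd ℝ F U) (k : ℕ)
    {x : ℝ} (hx : (0, x) ∈ U) : (k : ℕ∞) ≤ analyticOrderAt (fun t => F (t, x)) 0 ↔
      ∀ j < k, partialFst^[j] F (0, x) = 0 := by
  rw [natCast_le_analyticOrderAt_iff_iteratedDeriv_eq_zero (hF _ hx).fst_slice]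
  refine forall₂_congr fun j _ => ?_
  rw [← iteratedDeriv_fst_slice hU hF j hx]

/-- Differentiating in the second variable does not lower the order of vanishing in the first. -/
theorem natCast_le_analyticOrderAt_partialSnd (hU : IsOpen U) (hF : AnalyticOnNhd ℝ F U) (k : ℕ)
    {J : Set ℝ} (hJ : IsOpen J) (hJU : ∀ x ∈ J, (0, x) ∈ U)
    (h : ∀ x ∈ J, (k : ℕ∞) ≤ analyticOrderAt (fun t => F (t, x)) 0) {x : ℝ} (hx : x ∈ J) :
    (k : ℕ∞) ≤ analyticOrderAt (fun t => partialSnd F (t, x)) 0 := by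
  rw [natCast_le_analyticOrderAt_slice_iff hU hF.partialSnd k (hJU x hx)]
  intro j hj
  rw [iterate_partialFst_partialSnd hU hF j (hJU x hx)]
  have h1 := (hF.iterate_partialFst j _ (hJU x hx)).hasDerivAt_partialSnd
  have h2 : (fun x => partialFst^[j] F (0, x)) =ᶠ[𝓝 x] fun _ => 0 := by
    filter_upwards [hJ.mem_nhds hx] with z hz
    exact (natCast_le_analyticOrderAt_slice_iff hU hF k (hJU z hz)).1 (h z hz) j hj
  exact h1.unique ((hasDerivAt_const x (0 : ℝ)).congr_of_eventuallyEq h2)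

end Partial

theorem AnalyticAt.isBigO_pow_of_le_analyticOrderAt {φ : ℝ → ℝ} (hφ : AnalyticAt ℝ φ 0) {k : ℕ}
    (h : (k : ℕ∞) ≤ analyticOrderAt φ 0) : φ =O[𝓝 0] fun t => t ^ k := by
  obtain ⟨g, hg, he⟩ := (natCast_le_analyticOrderAt hφ).1 h
  have h1 : (fun t : ℝ => t ^ k * g t) =O[𝓝 0] fun t => t ^ k * 1 :=
    (Asymptotics.isBigO_refl _ _).mul (hg.continuousAt.isBigO_one ℝ)
  simp only [mul_one] at h1
  refine h1.congr' ?_ .rfl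
  filter_upwards [he] with t ht
  rw [ht]; simp

/-- A bound from the right is enough, which matters because the equations are available only at
positive times. If the order `m` were below `k`, the leading factor `g` would satisfy `|g t| ≤ c
t^(k - m)`, hence `g 0 = 0`. -/
theorem AnalyticAt.le_analyticOrderAt_of_isBigO {φ : ℝ → ℝ} (hφ : AnalyticAt ℝ φ 0) {k : ℕ}
    (h : φ =O[𝓝[>] 0] fun t => t ^ k) : (k : ℕ∞) ≤ analyticOrderAt φ 0 := by
  by_contra! hlt
  obtain ⟨m, hm⟩ := ENat.ne_top_iff_exists.1 hlt.ne_top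
  rw [← hm] at hlt
  have hmk : m < k := by exact_mod_cast hlt
  obtain ⟨g, hg, hg0, he⟩ := hφ.analyticOrderAt_eq_natCast.1 hm.symm
  obtain ⟨c, hc⟩ := h.bound
  have hlim : Tendsto (fun t : ℝ => c * t ^ (k - m)) (𝓝[>] 0) (𝓝 0) := by
    have : ContinuousAt (fun t : ℝ => c * t ^ (k - m)) 0 := by fun_prop
    have h2 := this.tendsto
    simp only [zero_pow (Nat.sub_pos_of_lt hmk).ne', mul_zero] at h2
    exact h2.mono_left nhdsWithin_le_nhds
  have hgl : Tendsto (fun t => |g t|) (𝓝[>] 0) (𝓝 |g 0|) :=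
    (hg.continuousAt.abs.tendsto).mono_left nhdsWithin_le_nhds
  have hle : |g 0| ≤ 0 := by
    refine le_of_tendsto_of_tendsto hgl hlim ?_
    filter_upwards [hc, he.filter_mono nhdsWithin_le_nhds, self_mem_nhdsWithin] with t h1 h2 h3
    have h3 : 0 < t := h3
    rw [h2, sub_zero, smul_eq_mul, norm_mul, norm_pow, norm_pow, Real.norm_eq_abs, Real.norm_eq_abs,
      abs_of_pos h3, ← Nat.add_sub_of_le hmk.le, pow_add] at h1
    have h4 : 0 < t ^ m := by positivity
    have h5 : t ^ m * |g t| ≤ t ^ m * (c * t ^ (k - m)) := by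
      calc _ ≤ _ := h1
        _ = _ := by ring
    exact le_of_mul_le_mul_left h5 h4
  exact hg0 (abs_nonpos_iff.1 hle)

/-! ### Uniqueness for the Cauchy problem among analytic solutions -/

namespace ColdPlasma

open Asymptotics

/-- If the difference of two solutions vanishes to order `k` at time `0`, so does its time
derivative. -/
theorem isBigO_time_deriv_sub {ν : ℝ → ℝ} {k : ℕ} {n₀ : ℝ} (hν : AnalyticAt ℝ ν n₀)
    {V₁ V₁t V₁x E₁ E₁t E₁x V₂ V₂t V₂x E₂ E₂t E₂x : ℝ → ℝ}
    (bV₁ : V₁ =O[𝓝[>] 0] fun _ => (1 : ℝ)) (bV₂x : V₂x =O[𝓝[>] 0] fun _ => (1 : ℝ))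
    (bE₂x : E₂x =O[𝓝[>] 0] fun _ => (1 : ℝ))
    (l₁ : Tendsto (fun t => 1 - E₁x t) (𝓝[>] 0) (𝓝 n₀))
    (l₂ : Tendsto (fun t => 1 - E₂x t) (𝓝[>] 0) (𝓝 n₀))
    (hV : (fun t => V₁ t - V₂ t) =O[𝓝[>] 0] fun t => t ^ k)
    (hVx : (fun t => V₁x t - V₂x t) =O[𝓝[>] 0] fun t => t ^ k)
    (hE : (fun t => E₁ t - E₂ t) =O[𝓝[>] 0] fun t => t ^ k)
    (hEx : (fun t => E₁x t - E₂x t) =O[𝓝[>] 0] fun t => t ^ k)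
    (eV₁ : ∀ᶠ t in 𝓝[>] 0, V₁t t + V₁ t * V₁x t = -E₁ t - ν (1 - E₁x t) * V₁ t)
    (eV₂ : ∀ᶠ t in 𝓝[>] 0, V₂t t + V₂ t * V₂x t = -E₂ t - ν (1 - E₂x t) * V₂ t)
    (eE₁ : ∀ᶠ t in 𝓝[>] 0, E₁t t + V₁ t * E₁x t = V₁ t)
    (eE₂ : ∀ᶠ t in 𝓝[>] 0, E₂t t + V₂ t * E₂x t = V₂ t) :
    (fun t => V₁t t - V₂t t) =O[𝓝[>] 0] (fun t => t ^ k) ∧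
      (fun t => E₁t t - E₂t t) =O[𝓝[>] 0] fun t => t ^ k := by
  have one : ∀ {f g : ℝ → ℝ}, (f =O[𝓝[>] 0] fun _ => (1 : ℝ)) →
      (g =O[𝓝[>] 0] fun t => t ^ k) → (fun t => f t * g t) =O[𝓝[>] 0] fun t => t ^ k := by
    intro f g hf hg
    simpa using hf.mul hg
  -- `ν` is Lipschitz near `n₀`, the common limit of both densities.
  have hνO : (fun t => ν (1 - E₁x t) - ν (1 - E₂x t)) =O[𝓝[>] 0] fun t => t ^ k := by
    have h1 := hν.hasStrictFDerivAt.isBigO_sub.comp_tendsto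
      ((l₁.prodMk l₂).mono_right (nhds_prod_eq (x := n₀) (y := n₀)).ge)
    refine h1.trans ?_
    have h2 : (fun t => -(E₁x t - E₂x t)) =O[𝓝[>] 0] fun t => t ^ k := hEx.neg_left
    refine h2.congr_left fun t => ?_
    simp
  have bν : (fun t => ν (1 - E₂x t)) =O[𝓝[>] 0] fun _ => (1 : ℝ) :=
    (hν.continuousAt.tendsto.comp l₂).isBigO_one ℝ
  constructor
  -- Products are telescoped: `V₁ V₁x - V₂ V₂x = V₁ (V₁x - V₂x) + V₂x (V₁ - V₂)`, and likewise for
  -- the damping term.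
  · have h := ((((one bV₁ hVx).add (one bV₂x hV)).add hE).add
      ((one bV₁ hνO).add (one bν hV))).neg_left
    refine h.congr' ?_ .rfl
    filter_upwards [eV₁, eV₂] with t h1 h2
    linear_combination h2 - h1
  · have h := hV.sub ((one bV₁ hEx).add (one bE₂x hV))
    refine h.congr' ?_ .rfl
    filter_upwards [eE₁, eE₂] with t h1 h2
    linear_combination h2 - h1

/-- Differentiation lowers the order of a function vanishing at `0` by exactly one; this is the gain
in the induction on the order. -/
theorem succ_le_analyticOrderAt_of_deriv {φ φ' : ℝ → ℝ} (hφ : AnalyticAt ℝ φ 0) (h0 : φ 0 = 0)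
    (hd : ∀ᶠ t in 𝓝 0, HasDerivAt φ (φ' t) t) {k : ℕ} (h : φ' =O[𝓝[>] 0] fun t => t ^ k) :
    ((k + 1 : ℕ) : ℕ∞) ≤ analyticOrderAt φ 0 := by
  have h1 : deriv φ =ᶠ[𝓝 0] φ' := hd.mono fun t ht => ht.deriv
  have h2 : (k : ℕ∞) ≤ analyticOrderAt (deriv φ) 0 :=
    hφ.deriv.le_analyticOrderAt_of_isBigO
      (h.congr' (h1.symm.filter_mono nhdsWithin_le_nhds) .rfl)
  have h3 := hφ.analyticOrderAt_deriv_add_one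
  simp only [h0, sub_zero] at h3
  rw [← h3]
  push_cast
  gcongr

/-- Local uniqueness for the Cauchy problem among analytic functions. -/
theorem local_unique {ν : ℝ → ℝ} {δ : ℝ} (hδ : 0 < δ) {J : Set ℝ} (hJ : IsOpen J)
    {V₁ E₁ V₂ E₂ : ℝ × ℝ → ℝ} (aV₁ : AnalyticOnNhd ℝ V₁ (Ioo (-δ) δ ×ˢ J))
    (aE₁ : AnalyticOnNhd ℝ E₁ (Ioo (-δ) δ ×ˢ J)) (aV₂ : AnalyticOnNhd ℝ V₂ (Ioo (-δ) δ ×ˢ J))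
    (aE₂ : AnalyticOnNhd ℝ E₂ (Ioo (-δ) δ ×ˢ J))
    (hν : ∀ x ∈ J, AnalyticAt ℝ ν (1 - partialSnd E₁ (0, x)))
    (eV₁ : ∀ t ∈ Ioo 0 δ, ∀ x ∈ J, partialFst V₁ (t, x) + V₁ (t, x) * partialSnd V₁ (t, x) =
      -E₁ (t, x) - ν (1 - partialSnd E₁ (t, x)) * V₁ (t, x))
    (eV₂ : ∀ t ∈ Ioo 0 δ, ∀ x ∈ J, partialFst V₂ (t, x) + V₂ (t, x) * partialSnd V₂ (t, x) =
      -E₂ (t, x) - ν (1 - partialSnd E₂ (t, x)) * V₂ (t, x))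
    (eE₁ : ∀ t ∈ Ioo 0 δ, ∀ x ∈ J,
      partialFst E₁ (t, x) + V₁ (t, x) * partialSnd E₁ (t, x) = V₁ (t, x))
    (eE₂ : ∀ t ∈ Ioo 0 δ, ∀ x ∈ J,
      partialFst E₂ (t, x) + V₂ (t, x) * partialSnd E₂ (t, x) = V₂ (t, x))
    (iV : ∀ x ∈ J, V₁ (0, x) = V₂ (0, x)) (iE : ∀ x ∈ J, E₁ (0, x) = E₂ (0, x)) :
    EqOn V₁ V₂ (Ioo (-δ) δ ×ˢ J) ∧ EqOn E₁ E₂ (Ioo (-δ) δ ×ˢ J) := by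
  set U : Set (ℝ × ℝ) := Ioo (-δ) δ ×ˢ J with hUdef
  have hU : IsOpen U := isOpen_Ioo.prod hJ
  have hJU : ∀ x ∈ J, ((0 : ℝ), x) ∈ U := fun x hx => ⟨⟨by linarith, hδ⟩, hx⟩
  have aV : AnalyticOnNhd ℝ (fun p => V₁ p - V₂ p) U := aV₁.sub aV₂
  have aE : AnalyticOnNhd ℝ (fun p => E₁ p - E₂ p) U := aE₁.sub aE₂
  have hpos : Ioo 0 δ ∈ 𝓝[>] (0 : ℝ) := Ioo_mem_nhdsGT hδ
  have hslice : ∀ {G : ℝ × ℝ → ℝ}, AnalyticOnNhd ℝ G U → ∀ x ∈ J,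
      AnalyticAt ℝ (fun t => G (t, x)) 0 := fun hG x hx => (hG _ (hJU x hx)).fst_slice
  have hsub : ∀ {G H : ℝ × ℝ → ℝ}, AnalyticOnNhd ℝ G U → AnalyticOnNhd ℝ H U → ∀ p ∈ U,
      partialSnd (fun q => G q - H q) p = partialSnd G p - partialSnd H p := by
    intro G H hG hH p hp
    simp only [partialSnd]
    rw [fderiv_fun_sub (hG p hp).differentiableAt (hH p hp).differentiableAt]
    rfl
  have hmemU : ∀ x ∈ J, ∀ᶠ t in 𝓝 (0 : ℝ), (t, x) ∈ U := by
    intro x hx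
    filter_upwards [Ioo_mem_nhds (by linarith : -δ < 0) hδ] with t ht using ⟨ht, hx⟩
  -- The induction treats all `x ∈ J` at once, because its step differentiates in `x`.
  have horder : ∀ k : ℕ, ∀ x ∈ J, (k : ℕ∞) ≤ analyticOrderAt (fun t => V₁ (t, x) - V₂ (t, x)) 0 ∧
      (k : ℕ∞) ≤ analyticOrderAt (fun t => E₁ (t, x) - E₂ (t, x)) 0 := by
    intro k
    induction k with
    | zero => simp
    | succ k ih =>
      intro x hx
      have one : ∀ {G : ℝ × ℝ → ℝ}, AnalyticOnNhd ℝ G U →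
          (fun t => G (t, x)) =O[𝓝[>] 0] fun _ => (1 : ℝ) := fun hG =>
        ((hslice hG x hx).continuousAt.isBigO_one ℝ).mono nhdsWithin_le_nhds
      have lim : ∀ {G : ℝ × ℝ → ℝ}, AnalyticOnNhd ℝ G U →
          Tendsto (fun t => 1 - partialSnd G (t, x)) (𝓝[>] 0) (𝓝 (1 - partialSnd G (0, x))) :=
        fun hG => ((hslice hG.partialSnd x hx).continuousAt.tendsto.mono_left
          nhdsWithin_le_nhds).const_sub 1
      have big : ∀ {G H : ℝ × ℝ → ℝ}, AnalyticOnNhd ℝ G U → AnalyticOnNhd ℝ H U →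
          (∀ x ∈ J, (k : ℕ∞) ≤ analyticOrderAt (fun t => G (t, x) - H (t, x)) 0) →
          ((fun t => G (t, x) - H (t, x)) =O[𝓝[>] 0] fun t => t ^ k) ∧
          ((fun t => partialSnd G (t, x) - partialSnd H (t, x)) =O[𝓝[>] 0] fun t => t ^ k) := by
        intro G H hG hH ho
        have hGH : AnalyticOnNhd ℝ (fun p => G p - H p) U := hG.sub hH
        refine ⟨((hslice hGH x hx).isBigO_pow_of_le_analyticOrderAt (ho x hx)).mono
          nhdsWithin_le_nhds, ?_⟩
        have h1 := natCast_le_analyticOrderAt_partialSnd hU hGH k hJ hJU ho hx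
        have h2 := ((hslice hGH.partialSnd x hx).isBigO_pow_of_le_analyticOrderAt h1)
        refine (h2.congr' ?_ .rfl).mono nhdsWithin_le_nhds
        filter_upwards [hmemU x hx] with t ht using hsub hG hH _ ht
      -- The data agree on the open set `J`, so both densities start from the same value `n₀` at
      -- `x`.
      have hE₁₂ : partialSnd E₁ (0, x) = partialSnd E₂ (0, x) := by
        refine (aE₁ _ (hJU x hx)).hasDerivAt_partialSnd.unique
          ((aE₂ _ (hJU x hx)).hasDerivAt_partialSnd.congr_of_eventuallyEq ?_)
        filter_upwards [hJ.mem_nhds hx] with z hz using iE z hz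
      obtain ⟨hV, hVx⟩ := big aV₁ aV₂ fun x hx => (ih x hx).1
      obtain ⟨hE, hEx⟩ := big aE₁ aE₂ fun x hx => (ih x hx).2
      obtain ⟨hVt, hEt⟩ := isBigO_time_deriv_sub (hν x hx)
        (V₁t := fun t => partialFst V₁ (t, x)) (V₂t := fun t => partialFst V₂ (t, x))
        (E₁t := fun t => partialFst E₁ (t, x)) (E₂t := fun t => partialFst E₂ (t, x))
        (one aV₁) (one aV₂.partialSnd) (one aE₂.partialSnd) (lim aE₁) (hE₁₂ ▸ lim aE₂)
        hV hVx hE hEx (by filter_upwards [hpos] with t ht using eV₁ t ht x hx)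
        (by filter_upwards [hpos] with t ht using eV₂ t ht x hx)
        (by filter_upwards [hpos] with t ht using eE₁ t ht x hx)
        (by filter_upwards [hpos] with t ht using eE₂ t ht x hx)
      constructor
      · refine succ_le_analyticOrderAt_of_deriv (hslice aV x hx) (by simp [iV x hx]) ?_ hVt
        filter_upwards [hmemU x hx] with t ht
        exact (aV₁ _ ht).hasDerivAt_partialFst.sub (aV₂ _ ht).hasDerivAt_partialFst
      · refine succ_le_analyticOrderAt_of_deriv (hslice aE x hx) (by simp [iE x hx]) ?_ hEt
        filter_upwards [hmemU x hx] with t ht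
        exact (aE₁ _ ht).hasDerivAt_partialFst.sub (aE₂ _ ht).hasDerivAt_partialFst
  have hzero : ∀ {G H : ℝ × ℝ → ℝ}, AnalyticOnNhd ℝ G U → AnalyticOnNhd ℝ H U →
      (∀ k : ℕ, ∀ x ∈ J, (k : ℕ∞) ≤ analyticOrderAt (fun t => G (t, x) - H (t, x)) 0) →
      EqOn G H U := by
    intro G H hG hH ho p hp
    have htop : analyticOrderAt (fun t => G (t, p.2) - H (t, p.2)) 0 = ⊤ :=
      ENat.eq_top_iff_forall_ge.2 fun k => ho k p.2 hp.2
    have ha : AnalyticOnNhd ℝ (fun t => G (t, p.2) - H (t, p.2)) (Ioo (-δ) δ) := fun t ht =>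
      ((hG (t, p.2) ⟨ht, hp.2⟩).fst_slice).sub ((hH (t, p.2) ⟨ht, hp.2⟩).fst_slice)
    have := ha.eqOn_zero_of_preconnected_of_eventuallyEq_zero isPreconnected_Ioo
      (⟨by linarith, hδ⟩ : (0 : ℝ) ∈ Ioo (-δ) δ) (analyticOrderAt_eq_top.1 htop) hp.1
    exact sub_eq_zero.1 this
  exact ⟨hzero aV₁ aV₂ fun k x hx => (horder k x hx).1,
    hzero aE₁ aE₂ fun k x hx => (horder k x hx).2⟩

/-- Analyticity relative to the half-strip at the boundary point `(0, 0)` provides an extension to a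
full neighbourhood. Stating it for all small `δ` lets several extensions share one box. -/
theorem exists_analytic_extension {W : ℝ → ℝ → ℝ} {τ : ℝ} (hτ : 0 < τ)
    (hW : AnalyticOn ℝ (fun p : ℝ × ℝ => W p.1 p.2) (Ico 0 τ ×ˢ univ)) :
    ∃ g : ℝ × ℝ → ℝ, ∀ᶠ δ in 𝓝[>] (0 : ℝ), AnalyticOnNhd ℝ g (Ioo (-δ) δ ×ˢ Ioo (-δ) δ) ∧
      ∀ t ∈ Ico 0 δ, ∀ x ∈ Ioo (-δ) δ, W t x = g (t, x) := by
  have h0 : ((0 : ℝ), (0 : ℝ)) ∈ Ico 0 τ ×ˢ (univ : Set ℝ) := ⟨⟨le_rfl, hτ⟩, mem_univ _⟩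
  obtain ⟨g, hWg, hg⟩ := analyticWithinAt_iff_exists_analyticAt.1 (hW _ h0)
  rw [insert_eq_of_mem h0] at hWg
  obtain ⟨ρ, hρ, hball⟩ := Metric.eventually_nhds_iff_ball.1
    (hg.eventually_analyticAt.and (eventually_nhdsWithin_iff.1 hWg))
  refine ⟨g, ?_⟩
  filter_upwards [Ioo_mem_nhdsGT (lt_min hρ hτ)] with δ hδ
  have hsub : Ioo (-δ) δ ×ˢ Ioo (-δ) δ ⊆ Metric.ball ((0 : ℝ), (0 : ℝ)) ρ := by
    rintro ⟨t, x⟩ ⟨ht, hx⟩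
    have hδρ : δ < ρ := hδ.2.trans_le (min_le_left _ _)
    rw [Metric.mem_ball, Prod.dist_eq, max_lt_iff]
    simp only [dist_zero_right, Real.norm_eq_abs]
    exact ⟨(abs_lt.2 ht).trans hδρ, (abs_lt.2 hx).trans hδρ⟩
  refine ⟨fun p hp => (hball p (hsub hp)).1, fun t ht x hx => ?_⟩
  exact (hball (t, x) (hsub ⟨⟨by linarith [ht.1, hδ.1], ht.2⟩, hx⟩)).2
    ⟨⟨ht.1, ht.2.trans (hδ.2.trans_le (min_le_right _ _))⟩, mem_univ _⟩

/-- Restricted to positive times, where `I` is a neighbourhood of `t` and `derivWithin` is the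
ordinary derivative. -/
theorem partial_eq_deriv {W : ℝ → ℝ → ℝ} {g : ℝ × ℝ → ℝ} {δ : ℝ} {I : Set ℝ}
    (hg : AnalyticOnNhd ℝ g (Ioo (-δ) δ ×ˢ Ioo (-δ) δ))
    (hWg : ∀ t ∈ Ico 0 δ, ∀ x ∈ Ioo (-δ) δ, W t x = g (t, x)) (hI : Ico 0 δ ⊆ I) {t x : ℝ}
    (ht : t ∈ Ioo 0 δ) (hx : x ∈ Ioo (-δ) δ) :
    partialFst g (t, x) = derivWithin (fun s => W s x) I t := by
  have hmem : Ioo 0 δ ∈ 𝓝 t := Ioo_mem_nhds ht.1 ht.2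
  rw [derivWithin_of_mem_nhds (mem_of_superset hmem (Ioo_subset_Ico_self.trans hI))]
  have h1 := (hg (t, x) ⟨⟨by linarith [ht.1, ht.2], ht.2⟩, hx⟩).hasDerivAt_partialFst
  refine (h1.congr_of_eventuallyEq ?_).deriv.symm
  filter_upwards [hmem] with s hs using hWg s ⟨hs.1.le, hs.2⟩ x hx

theorem partial_eq_deriv_space {W : ℝ → ℝ → ℝ} {g : ℝ × ℝ → ℝ} {δ : ℝ}
    (hg : AnalyticOnNhd ℝ g (Ioo (-δ) δ ×ˢ Ioo (-δ) δ))
    (hWg : ∀ t ∈ Ico 0 δ, ∀ x ∈ Ioo (-δ) δ, W t x = g (t, x)) {t x : ℝ}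
    (ht : t ∈ Ico 0 δ) (hx : x ∈ Ioo (-δ) δ) :
    partialSnd g (t, x) = deriv (W t) x := by
  have h1 := (hg (t, x) ⟨⟨by linarith [ht.1, ht.2], ht.2⟩, hx⟩).hasDerivAt_partialSnd
  refine (h1.congr_of_eventuallyEq ?_).deriv.symm
  filter_upwards [Ioo_mem_nhds hx.1 hx.2] with z hz using hWg t ht z hz

/-- Two analytic solutions of the Cauchy problem with the same data agree at common times. -/
theorem IsSolution.eq_of_subset {ν : ℝ → ℝ} (hν : AnalyticOnNhd ℝ ν (Ioi 0)) {I₁ I₂ : Set ℝ}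
    {V₀ E₀ : ℝ → ℝ} {V₁ E₁ V₂ E₂ : ℝ → ℝ → ℝ} (h₁ : IsSolution ν I₁ V₀ E₀ V₁ E₁)
    (h₂ : IsSolution ν I₂ V₀ E₀ V₂ E₂) {τ : ℝ} (hτ : 0 < τ) (hI₁ : Ico 0 τ ⊆ I₁)
    (hI₂ : Ico 0 τ ⊆ I₂) {t : ℝ} (ht : t ∈ Ico 0 τ) (x : ℝ) :
    V₁ t x = V₂ t x ∧ E₁ t x = E₂ t x := by
  have ext : ∀ {I : Set ℝ} {W : ℝ → ℝ → ℝ}, Ico 0 τ ⊆ I →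
      AnalyticOn ℝ (fun p : ℝ × ℝ => W p.1 p.2) (I ×ˢ univ) → _ := fun {I W} hI hW =>
    exists_analytic_extension (W := W) hτ (hW.mono (prod_mono hI subset_rfl))
  obtain ⟨v₁, hv₁⟩ := ext hI₁ h₁.analytic_V
  obtain ⟨e₁, he₁⟩ := ext hI₁ h₁.analytic_E
  obtain ⟨v₂, hv₂⟩ := ext hI₂ h₂.analytic_V
  obtain ⟨e₂, he₂⟩ := ext hI₂ h₂.analytic_E
  obtain ⟨δ, ⟨av₁, gv₁⟩, ⟨ae₁, ge₁⟩, ⟨av₂, gv₂⟩, ⟨ae₂, ge₂⟩, hδ⟩ :=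
    (hv₁.and (he₁.and (hv₂.and (he₂.and (Ioo_mem_nhdsGT hτ))))).exists
  have hδ0 : 0 < δ := hδ.1
  have hδτ : Ico 0 δ ⊆ Ico 0 τ := Ico_subset_Ico_right hδ.2.le
  have h00 : (0 : ℝ) ∈ Ico 0 δ := ⟨le_rfl, hδ0⟩
  have hloc := local_unique (ν := ν) hδ0 isOpen_Ioo av₁ ae₁ av₂ ae₂
    (fun x hx => hν _ (by
      rw [partial_eq_deriv_space ae₁ ge₁ h00 hx]
      exact h₁.density_pos 0 (hI₁ (hδτ h00)) x))
    (fun t ht x hx => by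
      have ht' : t ∈ Ico 0 δ := ⟨ht.1.le, ht.2⟩
      rw [partial_eq_deriv av₁ gv₁ (hδτ.trans hI₁) ht hx, partial_eq_deriv_space av₁ gv₁ ht' hx,
        partial_eq_deriv_space ae₁ ge₁ ht' hx, ← gv₁ t ht' x hx, ← ge₁ t ht' x hx]
      exact h₁.eq_V t (hI₁ (hδτ ht')) x)
    (fun t ht x hx => by
      have ht' : t ∈ Ico 0 δ := ⟨ht.1.le, ht.2⟩
      rw [partial_eq_deriv av₂ gv₂ (hδτ.trans hI₂) ht hx, partial_eq_deriv_space av₂ gv₂ ht' hx,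
        partial_eq_deriv_space ae₂ ge₂ ht' hx, ← gv₂ t ht' x hx, ← ge₂ t ht' x hx]
      exact h₂.eq_V t (hI₂ (hδτ ht')) x)
    (fun t ht x hx => by
      have ht' : t ∈ Ico 0 δ := ⟨ht.1.le, ht.2⟩
      rw [partial_eq_deriv ae₁ ge₁ (hδτ.trans hI₁) ht hx,
        partial_eq_deriv_space ae₁ ge₁ ht' hx, ← gv₁ t ht' x hx]
      exact h₁.eq_E t (hI₁ (hδτ ht')) x)
    (fun t ht x hx => by
      have ht' : t ∈ Ico 0 δ := ⟨ht.1.le, ht.2⟩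
      rw [partial_eq_deriv ae₂ ge₂ (hδτ.trans hI₂) ht hx,
        partial_eq_deriv_space ae₂ ge₂ ht' hx, ← gv₂ t ht' x hx]
      exact h₂.eq_E t (hI₂ (hδτ ht')) x)
    (fun x hx => by rw [← gv₁ 0 h00 x hx, ← gv₂ 0 h00 x hx, h₁.init_V, h₂.init_V])
    (fun x hx => by rw [← ge₁ 0 h00 x hx, ← ge₂ 0 h00 x hx, h₁.init_E, h₂.init_E])
  -- Time `0` is settled by the data; positive times follow from the identity theorem on the open
  -- strip `(0, τ) × ℝ`, started at `(δ / 2, 0)` inside the local box.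
  rcases ht.1.eq_or_lt with h0 | hpos
  · rw [← h0, h₁.init_V, h₂.init_V, h₁.init_E, h₂.init_E]
    exact ⟨rfl, rfl⟩
  have glob : ∀ {I I' : Set ℝ} {W W' : ℝ → ℝ → ℝ} {g g' : ℝ × ℝ → ℝ}, Ico 0 τ ⊆ I → Ico 0 τ ⊆ I' →
      AnalyticOn ℝ (fun p : ℝ × ℝ => W p.1 p.2) (I ×ˢ univ) →
      AnalyticOn ℝ (fun p : ℝ × ℝ => W' p.1 p.2) (I' ×ˢ univ) →
      (∀ t ∈ Ico 0 δ, ∀ x ∈ Ioo (-δ) δ, W t x = g (t, x)) →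
      (∀ t ∈ Ico 0 δ, ∀ x ∈ Ioo (-δ) δ, W' t x = g' (t, x)) →
      EqOn g g' (Ioo (-δ) δ ×ˢ Ioo (-δ) δ) → W t x = W' t x := by
    intro I I' W W' g g' hI hI' hW hW' hg hg' hgg'
    have hopen : IsOpen (Ioo 0 τ ×ˢ (univ : Set ℝ)) := isOpen_Ioo.prod isOpen_univ
    have hconn : IsPreconnected (Ioo 0 τ ×ˢ (univ : Set ℝ)) :=
      isPreconnected_Ioo.prod isPreconnected_univ
    have ha := hopen.analyticOn_iff_analyticOnNhd.1
      (hW.mono (prod_mono (Ioo_subset_Ico_self.trans hI) subset_rfl))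
    have ha' := hopen.analyticOn_iff_analyticOnNhd.1
      (hW'.mono (prod_mono (Ioo_subset_Ico_self.trans hI') subset_rfl))
    have hmem : ((δ / 2, 0) : ℝ × ℝ) ∈ Ioo 0 τ ×ˢ (univ : Set ℝ) :=
      ⟨⟨by positivity, by linarith [hδ.2]⟩, mem_univ _⟩
    refine ha.eqOn_of_preconnected_of_eventuallyEq ha' hconn hmem ?_
      (show (t, x) ∈ Ioo 0 τ ×ˢ (univ : Set ℝ) from ⟨⟨hpos, ht.2⟩, mem_univ _⟩)
    have hnhds : Ioo 0 δ ×ˢ Ioo (-δ) δ ∈ 𝓝 ((δ / 2, 0) : ℝ × ℝ) :=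
      prod_mem_nhds (Ioo_mem_nhds (by linarith) (by linarith))
        (Ioo_mem_nhds (by linarith) (by linarith))
    filter_upwards [hnhds] with p hp
    have hp1 : p.1 ∈ Ico 0 δ := ⟨hp.1.1.le, hp.1.2⟩
    rw [hg _ hp1 _ hp.2, hg' _ hp1 _ hp.2]
    exact hgg' ⟨⟨by linarith [hp.1.1], hp.1.2⟩, hp.2⟩
  exact ⟨glob hI₁ hI₂ h₁.analytic_V h₂.analytic_V gv₁ gv₂ hloc.1,
    glob hI₁ hI₂ h₁.analytic_E h₂.analytic_E ge₁ ge₂ hloc.2⟩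

/-- The condition on `I` describes an initial time interval without a last point, so each common
time lies in a common `[0, τ)`. -/
theorem IsSolution.isUniqueOn {ν : ℝ → ℝ} (hν : AnalyticOnNhd ℝ ν (Ioi 0)) {I : Set ℝ}
    (hI : ∀ t ∈ I, 0 ≤ t ∧ Icc 0 t ⊆ I ∧ ∃ s ∈ I, t < s) {V₀ E₀ : ℝ → ℝ} {V E : ℝ → ℝ → ℝ}
    (h : IsSolution ν I V₀ E₀ V E) : IsUniqueOn ν I V₀ E₀ V E := by
  intro T' hT' V' E' h' t ht x
  obtain ⟨h0, -, s, hs, hts⟩ := hI t ht.1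
  have hτ : t < min s T' := lt_min hts ht.2.2
  refine h'.eq_of_subset hν h (h0.trans_lt hτ) (Ico_subset_Ico_right (min_le_right _ _)) ?_
    ⟨h0, hτ⟩ x
  exact fun r hr => (hI s hs).2.1 ⟨hr.1, (hr.2.trans_le (min_le_left _ _)).le⟩

/-! ### Reduction of affine solutions to an ordinary differential system -/

theorem analyticAt_fst_comp {E F G : Type*} [NormedAddCommGroup E] [NormedSpace ℝ E]
    [NormedAddCommGroup F] [NormedSpace ℝ F] [NormedAddCommGroup G] [NormedSpace ℝ G]
    {y : E → F × G} {p : E} (h : AnalyticAt ℝ y p) : AnalyticAt ℝ (fun p => (y p).1) p :=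
  AnalyticAt.comp (g := Prod.fst) (f := y) analyticAt_fst h

theorem analyticAt_snd_comp {E F G : Type*} [NormedAddCommGroup E] [NormedSpace ℝ E]
    [NormedAddCommGroup F] [NormedSpace ℝ F] [NormedAddCommGroup G] [NormedSpace ℝ G]
    {y : E → F × G} {p : E} (h : AnalyticAt ℝ y p) : AnalyticAt ℝ (fun p => (y p).2) p :=
  AnalyticAt.comp (g := Prod.snd) (f := y) analyticAt_snd h

/-- The vector field of the affine flow, in the variables `u = 1 / n`, `w = V_x / n` and the values
`q`, `r` of `E`, `V` along the characteristic issued from the origin. -/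
noncomputable def affineField (ν : ℝ → ℝ) (p : ℝ × ℝ × ℝ × ℝ) : ℝ × ℝ × ℝ × ℝ :=
  (p.2.1, 1 - p.1 - ν p.1⁻¹ * p.2.1, p.2.2.2, -p.2.2.1 - ν p.1⁻¹ * p.2.2.2)

theorem analyticOnNhd_affineField {ν : ℝ → ℝ} (hν : AnalyticOnNhd ℝ ν (Ioi 0)) :
    AnalyticOnNhd ℝ (affineField ν) {p | 0 < p.1} := by
  intro p hp
  have hp : 0 < p.1 := hp
  have h1 : AnalyticAt ℝ (fun p : ℝ × ℝ × ℝ × ℝ => p.1⁻¹) p := analyticAt_fst.inv hp.ne'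
  have h2 : AnalyticAt ℝ (fun p : ℝ × ℝ × ℝ × ℝ => ν p.1⁻¹) p :=
    AnalyticAt.comp (g := ν) (hν _ (inv_pos.2 hp)) h1
  have h3 : AnalyticAt ℝ (fun p : ℝ × ℝ × ℝ × ℝ => p.2) p := analyticAt_snd
  have hw := analyticAt_fst_comp h3
  have hq := analyticAt_fst_comp (analyticAt_snd_comp h3)
  have hr := analyticAt_snd_comp (analyticAt_snd_comp h3)
  exact hw.prod (((analyticAt_const.sub analyticAt_fst).sub (h2.mul hw)).prod
    (hr.prod (hq.neg.sub (h2.mul hr))))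

theorem isOpen_fst_pos : IsOpen {p : ℝ × ℝ × ℝ × ℝ | 0 < p.1} :=
  isOpen_lt continuous_const continuous_fst

theorem hasDerivAt_fst_comp {F G : Type*} [NormedAddCommGroup F] [NormedSpace ℝ F]
    [NormedAddCommGroup G] [NormedSpace ℝ G] {y : ℝ → F × G} {y' : F × G} {t : ℝ}
    (h : HasDerivAt y y' t) : HasDerivAt (fun t => (y t).1) y'.1 t :=
  (ContinuousLinearMap.fst ℝ F G).hasFDerivAt.comp_hasDerivAt t h

theorem hasDerivAt_snd_comp {F G : Type*} [NormedAddCommGroup F] [NormedSpace ℝ F]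
    [NormedAddCommGroup G] [NormedSpace ℝ G] {y : ℝ → F × G} {y' : F × G} {t : ℝ}
    (h : HasDerivAt y y' t) : HasDerivAt (fun t => (y t).2) y'.2 t :=
  (ContinuousLinearMap.snd ℝ F G).hasFDerivAt.comp_hasDerivAt t h

/-- A quadruple of functions solving the system of the affine flow on `I`. -/
structure IsAffineFlow (ν : ℝ → ℝ) (I : Set ℝ) (u w q r : ℝ → ℝ) : Prop where
  pos : ∀ t ∈ I, 0 < u t
  deriv_u : ∀ t ∈ I, HasDerivAt u (w t) t
  deriv_w : ∀ t ∈ I, HasDerivAt w (1 - u t - ν (u t)⁻¹ * w t) t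
  deriv_q : ∀ t ∈ I, HasDerivAt q (r t) t
  deriv_r : ∀ t ∈ I, HasDerivAt r (-q t - ν (u t)⁻¹ * r t) t

theorem isAffineFlow_of_isTrajectoryOn {ν : ℝ → ℝ} {I : Set ℝ} {y : ℝ → ℝ × ℝ × ℝ × ℝ}
    (hy : IsTrajectoryOn (affineField ν) {p | 0 < p.1} I y) :
    IsAffineFlow ν I (fun t => (y t).1) (fun t => (y t).2.1) (fun t => (y t).2.2.1)
      (fun t => (y t).2.2.2) where
  pos t ht := (hy t ht).1
  deriv_u t ht := hasDerivAt_fst_comp (hy t ht).2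
  deriv_w t ht := hasDerivAt_fst_comp (hasDerivAt_snd_comp (hy t ht).2)
  deriv_q t ht := hasDerivAt_fst_comp (hasDerivAt_snd_comp (hasDerivAt_snd_comp (hy t ht).2))
  deriv_r t ht := hasDerivAt_snd_comp (hasDerivAt_snd_comp (hasDerivAt_snd_comp (hy t ht).2))

theorem IsAffineFlow.mono {ν : ℝ → ℝ} {I J : Set ℝ} {u w q r : ℝ → ℝ}
    (h : IsAffineFlow ν I u w q r) (hJ : J ⊆ I) : IsAffineFlow ν J u w q r :=
  ⟨fun t ht => h.pos t (hJ ht), fun t ht => h.deriv_u t (hJ ht), fun t ht => h.deriv_w t (hJ ht),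
    fun t ht => h.deriv_q t (hJ ht), fun t ht => h.deriv_r t (hJ ht)⟩

/-- The velocity of the affine flow. -/
noncomputable def affineVelocity (u w q r : ℝ → ℝ) (t x : ℝ) : ℝ :=
  w t / u t * (x - (q t - q 0)) + r t

/-- The electric field of the affine flow. -/
noncomputable def affineElectric (u q : ℝ → ℝ) (t x : ℝ) : ℝ :=
  (1 - (u t)⁻¹) * (x - (q t - q 0)) + q t

theorem deriv_affineVelocity (u w q r : ℝ → ℝ) (t x : ℝ) :
    deriv (affineVelocity u w q r t) x = w t / u t := by
  have h : HasDerivAt (affineVelocity u w q r t) (w t / u t * 1) x :=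
    (((hasDerivAt_id x).sub_const (q t - q 0)).const_mul _).add_const (r t)
  rw [h.deriv, mul_one]

theorem deriv_affineElectric (u q : ℝ → ℝ) (t x : ℝ) :
    deriv (affineElectric u q t) x = 1 - (u t)⁻¹ := by
  have h : HasDerivAt (affineElectric u q t) ((1 - (u t)⁻¹) * 1) x :=
    (((hasDerivAt_id x).sub_const (q t - q 0)).const_mul _).add_const (q t)
  rw [h.deriv, mul_one]

theorem isAffineOn_affineVelocity (I : Set ℝ) (u w q r : ℝ → ℝ) :
    IsAffineOn I (affineVelocity u w q r) :=
  ⟨fun t => w t / u t, fun t => r t - w t / u t * (q t - q 0), fun t _ x => by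
    unfold affineVelocity; ring⟩

theorem isAffineOn_affineElectric (I : Set ℝ) (u q : ℝ → ℝ) :
    IsAffineOn I (affineElectric u q) :=
  ⟨fun t => 1 - (u t)⁻¹, fun t => q t - (1 - (u t)⁻¹) * (q t - q 0), fun t _ x => by
    unfold affineElectric; ring⟩

/-- The characteristic `X` from the origin satisfies `X' = V = r = q'`, hence `X = q - q 0`. `V` and
`E` are written as affine functions of `x - X` with values `r`, `q` and slopes `w / u`, `1 - 1 / u`,
and the equations become an algebraic identity. -/
theorem IsAffineFlow.isSolution {ν : ℝ → ℝ} {I : Set ℝ} {u w q r : ℝ → ℝ}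
    (h : IsAffineFlow ν I u w q r) (hI : UniqueDiffOn ℝ I)
    (hu : ∀ t ∈ I, AnalyticAt ℝ u t) (hw : ∀ t ∈ I, AnalyticAt ℝ w t)
    (hq : ∀ t ∈ I, AnalyticAt ℝ q t) (hr : ∀ t ∈ I, AnalyticAt ℝ r t)
    {a₀ A₀ b₀ B₀ : ℝ} (ha : w 0 / u 0 = a₀) (hA : r 0 = A₀) (hb : 1 - (u 0)⁻¹ = b₀)
    (hB : q 0 = B₀) :
    IsSolution ν I (fun x => a₀ * x + A₀) (fun x => b₀ * x + B₀) (affineVelocity u w q r)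
      (affineElectric u q) where
  analytic_V := by
    rintro ⟨t, x⟩ ⟨ht, -⟩
    have c : ∀ {φ : ℝ → ℝ}, AnalyticAt ℝ φ t → AnalyticAt ℝ (fun p : ℝ × ℝ => φ p.1) (t, x) :=
      fun hφ => AnalyticAt.comp (f := Prod.fst) (x := (t, x)) hφ analyticAt_fst
    have hx : AnalyticAt ℝ (fun p : ℝ × ℝ => p.2) (t, x) := analyticAt_snd
    exact ((((c (hw t ht)).div (c (hu t ht)) (h.pos t ht).ne').mul
      (hx.sub ((c (hq t ht)).sub analyticAt_const))).add (c (hr t ht))).analyticWithinAt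
  analytic_E := by
    rintro ⟨t, x⟩ ⟨ht, -⟩
    have c : ∀ {φ : ℝ → ℝ}, AnalyticAt ℝ φ t → AnalyticAt ℝ (fun p : ℝ × ℝ => φ p.1) (t, x) :=
      fun hφ => AnalyticAt.comp (f := Prod.fst) (x := (t, x)) hφ analyticAt_fst
    have hx : AnalyticAt ℝ (fun p : ℝ × ℝ => p.2) (t, x) := analyticAt_snd
    exact (((analyticAt_const.sub ((c (hu t ht)).inv (h.pos t ht).ne')).mul
      (hx.sub ((c (hq t ht)).sub analyticAt_const))).add (c (hq t ht))).analyticWithinAt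
  density_pos := by
    intro t ht x
    rw [density, deriv_affineElectric, sub_sub_cancel]
    exact inv_pos.2 (h.pos t ht)
  eq_V := by
    intro t ht x
    have hut := (h.pos t ht).ne'
    have hd := ((((h.deriv_w t ht).div (h.deriv_u t ht) hut).mul
      (((h.deriv_q t ht).sub_const (q 0)).const_sub x)).add (h.deriv_r t ht))
    have hd' : derivWithin (fun s => affineVelocity u w q r s x) I t = _ :=
      hd.hasDerivWithinAt.derivWithin (hI t ht)
    rw [hd', density, deriv_affineElectric, deriv_affineVelocity, sub_sub_cancel]
    simp only [affineVelocity, affineElectric, Pi.div_apply]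
    field_simp
    ring
  eq_E := by
    intro t ht x
    have hut := (h.pos t ht).ne'
    have hd := ((((h.deriv_u t ht).inv hut).const_sub 1).mul
      (((h.deriv_q t ht).sub_const (q 0)).const_sub x)).add (h.deriv_q t ht)
    have hd' : derivWithin (fun s => affineElectric u q s x) I t = _ :=
      hd.hasDerivWithinAt.derivWithin (hI t ht)
    rw [hd', deriv_affineElectric]
    simp only [affineVelocity, Pi.inv_apply]
    field_simp
    ring
  init_V x := by simp [affineVelocity, ha, hA]
  init_E x := by simp [affineElectric, hb, hB]

/-! ### A priori bounds: energy and the Liénard variable -/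

/-- The energy of a damped oscillator does not grow. -/
theorem damped_energy_le {γ x v : ℝ → ℝ} {T : ℝ} (hγ : ∀ t ∈ Ico 0 T, 0 ≤ γ t)
    (hx : ∀ t ∈ Ico 0 T, HasDerivAt x (v t) t)
    (hv : ∀ t ∈ Ico 0 T, HasDerivAt v (-x t - γ t * v t) t) {t : ℝ} (ht : t ∈ Ico 0 T) :
    x t ^ 2 + v t ^ 2 ≤ x 0 ^ 2 + v 0 ^ 2 := by
  have hsub : Icc 0 t ⊆ Ico 0 T := fun s hs => ⟨hs.1, hs.2.trans_lt ht.2⟩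
  have hd : ∀ s ∈ Icc 0 t, HasDerivAt (fun s => x s ^ 2 + v s ^ 2) (-2 * γ s * v s ^ 2) s := by
    intro s hs
    refine (((hx s (hsub hs)).pow 2).add ((hv s (hsub hs)).pow 2)).congr_deriv ?_
    push_cast
    ring
  have hanti : AntitoneOn (fun s => x s ^ 2 + v s ^ 2) (Icc 0 t) := by
    refine antitoneOn_of_deriv_nonpos (convex_Icc 0 t)
      (fun s hs => (hd s hs).continuousAt.continuousWithinAt)
      (fun s hs => (hd s (interior_subset hs)).differentiableAt.differentiableWithinAt)
      fun s hs => ?_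
    rw [(hd s (interior_subset hs)).deriv]
    nlinarith [mul_nonneg (hγ s (hsub (interior_subset hs))) (sq_nonneg (v s))]
  exact hanti ⟨le_rfl, ht.1⟩ ⟨ht.1, le_rfl⟩ ht.1

/-- A function that does not decrease while it is below a level cannot cross that level. -/
theorem le_of_deriv_nonneg_below {z z' : ℝ → ℝ} {T m : ℝ}
    (hz : ∀ t ∈ Ico 0 T, HasDerivAt z (z' t) t) (h0 : m ≤ z 0)
    (h : ∀ t ∈ Ico 0 T, z t < m → 0 ≤ z' t) {t : ℝ} (ht : t ∈ Ico 0 T) : m ≤ z t := by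
  by_contra! hlt
  have hsub : Icc 0 t ⊆ Ico 0 T := fun s hs => ⟨hs.1, hs.2.trans_lt ht.2⟩
  have hc : ContinuousOn z (Icc 0 t) := fun s hs =>
    (hz s (hsub hs)).continuousAt.continuousWithinAt
  have hcl : IsCompact (Icc 0 t ∩ z ⁻¹' Ici m) :=
    isCompact_Icc.of_isClosed_subset (hc.preimage_isClosed_of_isClosed isClosed_Icc isClosed_Ici)
      inter_subset_left
  -- `t₀` is the last time up to `t` with `m ≤ z`. After it `z` is below `m`, hence nondecreasing,
  -- and cannot end below `z t₀`.
  obtain ⟨t₀, ⟨ht₀, hmt₀⟩, hmax⟩ := hcl.exists_isGreatest ⟨0, ⟨le_rfl, ht.1⟩, h0⟩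
  have hsub' : Icc t₀ t ⊆ Icc 0 t := Icc_subset_Icc_left ht₀.1
  have hmono : MonotoneOn z (Icc t₀ t) := by
    refine monotoneOn_of_deriv_nonneg (convex_Icc t₀ t) (hc.mono hsub')
      (fun s hs => (hz s (hsub (hsub' (interior_subset hs)))).differentiableAt.differentiableWithinAt)
      fun s hs => ?_
    rw [(hz s (hsub (hsub' (interior_subset hs)))).deriv]
    rw [interior_Icc] at hs
    have hs' : s ∈ Icc 0 t := ⟨ht₀.1.trans hs.1.le, hs.2.le⟩
    refine h s (hsub hs') ?_
    by_contra! hcon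
    exact absurd (hmax ⟨hs', hcon⟩) (not_le.2 hs.1)
  exact absurd (hmono ⟨le_rfl, ht₀.2⟩ ⟨ht₀.2, le_rfl⟩ ht₀.2) (not_le.2 (hlt.trans_le hmt₀))

section Bounds

variable {ν Φ : ℝ → ℝ} {T : ℝ} {u w q r : ℝ → ℝ}

theorem IsAffineFlow.energy_uw (h : IsAffineFlow ν (Ico 0 T) u w q r)
    (hν : ∀ n, 0 < n → 0 ≤ ν n) {t : ℝ} (ht : t ∈ Ico 0 T) :
    (u t - 1) ^ 2 + w t ^ 2 ≤ (u 0 - 1) ^ 2 + w 0 ^ 2 := by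
  refine damped_energy_le (γ := fun t => ν (u t)⁻¹) (x := fun t => u t - 1)
    (fun t ht => hν _ (inv_pos.2 (h.pos t ht))) (fun t ht => (h.deriv_u t ht).sub_const 1)
    (fun t ht => ?_) ht
  convert h.deriv_w t ht using 1
  ring

theorem IsAffineFlow.energy_qr (h : IsAffineFlow ν (Ico 0 T) u w q r)
    (hν : ∀ n, 0 < n → 0 ≤ ν n) {t : ℝ} (ht : t ∈ Ico 0 T) :
    q t ^ 2 + r t ^ 2 ≤ q 0 ^ 2 + r 0 ^ 2 :=
  damped_energy_le (γ := fun t => ν (u t)⁻¹) (fun t ht => hν _ (inv_pos.2 (h.pos t ht)))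
    h.deriv_q h.deriv_r ht

/-- The damping term `-ν(1/u) w` equals `-(Φ ∘ u)'`, so adding `Φ(u)` to `w` cancels it. -/
theorem IsAffineFlow.deriv_lienard (h : IsAffineFlow ν (Ico 0 T) u w q r)
    (hΦ : ∀ s, 0 < s → HasDerivAt Φ (ν s⁻¹) s) {t : ℝ} (ht : t ∈ Ico 0 T) :
    HasDerivAt (fun t => w t + Φ (u t)) (1 - u t) t := by
  refine ((h.deriv_w t ht).add ((hΦ _ (h.pos t ht)).comp t (h.deriv_u t ht))).congr_deriv ?_
  ring

/-- Lower bound for the Liénard variable. -/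
theorem IsAffineFlow.le_lienard (h : IsAffineFlow ν (Ico 0 T) u w q r)
    (hν : ∀ n, 0 < n → 0 ≤ ν n) (hΦ : ∀ s, 0 < s → HasDerivAt Φ (ν s⁻¹) s)
    {C : ℝ} (hC : ∀ t ∈ Ico 0 T, -C ≤ w t) {t : ℝ} (ht : t ∈ Ico 0 T) :
    min (w 0 + Φ (u 0)) (-C + Φ 1) ≤ w t + Φ (u t) := by
  have hmono : MonotoneOn Φ (Ioi 0) := by
    refine monotoneOn_of_deriv_nonneg (convex_Ioi 0)
      (fun s hs => (hΦ s hs).continuousAt.continuousWithinAt)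
      (fun s hs => (hΦ s (interior_subset hs)).differentiableAt.differentiableWithinAt)
      fun s hs => ?_
    have hs : 0 < s := interior_subset (s := Ioi (0 : ℝ)) hs
    rw [(hΦ s hs).deriv]
    exact hν _ (inv_pos.2 hs)
  refine le_of_deriv_nonneg_below (z := fun t => w t + Φ (u t))
    (fun t ht => h.deriv_lienard hΦ ht) (min_le_left _ _) (fun t ht hlt => ?_) ht
  -- The derivative `1 - u` is negative only for `u > 1`; there `w ≥ -C` and `Φ(u) ≥ Φ(1)` already
  -- keep the variable above the minimum.
  by_contra! hneg
  have h1 : 1 ≤ u t := by linarith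
  have h2 := hmono (mem_Ioi.2 one_pos) (mem_Ioi.2 (h.pos t ht)) h1
  have h3 := hlt.trans_le (min_le_right _ _)
  linarith [hC t ht]

/-- Upper bound for the Liénard variable. -/
theorem IsAffineFlow.lienard_le (h : IsAffineFlow ν (Ico 0 T) u w q r)
    (hΦ : ∀ s, 0 < s → HasDerivAt Φ (ν s⁻¹) s) {t : ℝ} (ht : t ∈ Ico 0 T) :
    w t + Φ (u t) ≤ w 0 + Φ (u 0) + t := by
  have hsub : Icc 0 t ⊆ Ico 0 T := fun s hs => ⟨hs.1, hs.2.trans_lt ht.2⟩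
  have hd : ∀ s ∈ Icc 0 t, HasDerivAt (fun s => w s + Φ (u s) - s) (1 - u s - 1) s :=
    fun s hs => (h.deriv_lienard hΦ (hsub hs)).sub (hasDerivAt_id s)
  have hanti : AntitoneOn (fun s => w s + Φ (u s) - s) (Icc 0 t) := by
    refine antitoneOn_of_deriv_nonpos (convex_Icc 0 t)
      (fun s hs => (hd s hs).continuousAt.continuousWithinAt)
      (fun s hs => (hd s (interior_subset hs)).differentiableAt.differentiableWithinAt)
      fun s hs => ?_
    rw [(hd s (interior_subset hs)).deriv]
    linarith [h.pos s (hsub (interior_subset hs))]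
  have := hanti ⟨le_rfl, ht.1⟩ ⟨ht.1, le_rfl⟩ ht.1
  simp only at this
  linarith

end Bounds

/-! ### The potential and the integral of `f η / η ^ 2` -/

section Potential

variable {f : ℝ → ℝ}

theorem continuousOn_div_sq (hf : ContinuousOn f (Ioi 0)) :
    ContinuousOn (fun η => f η / η ^ 2) (Ioi 0) :=
  hf.div (by fun_prop) fun η hη => pow_ne_zero 2 (ne_of_gt hη)

theorem intervalIntegrable_div_sq (hf : ContinuousOn f (Ioi 0)) {a b : ℝ} (ha : 0 < a)
    (hb : 0 < b) : IntervalIntegrable (fun η => f η / η ^ 2) volume a b :=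
  ((continuousOn_div_sq hf).mono fun _ hx => (lt_min ha hb).trans_le hx.1).intervalIntegrable

theorem hasDerivAt_integral_div_sq (hf : ContinuousOn f (Ioi 0)) {a R : ℝ} (ha : 0 < a)
    (hR : 0 < R) : HasDerivAt (fun R => ∫ η in a..R, f η / η ^ 2) (f R / R ^ 2) R :=
  intervalIntegral.integral_hasDerivAt_right (intervalIntegrable_div_sq hf ha hR)
    ((continuousOn_div_sq hf).stronglyMeasurableAtFilter isOpen_Ioi R hR)
    ((continuousOn_div_sq hf).continuousAt (Ioi_mem_nhds hR))

/-- A primitive of `u ↦ f (1 / u)`, written with the integral of `f η / η ^ 2`. -/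
theorem hasDerivAt_neg_integral_inv (hf : ContinuousOn f (Ioi 0)) {a u : ℝ} (ha : 0 < a)
    (hu : 0 < u) : HasDerivAt (fun u => -∫ η in a..u⁻¹, f η / η ^ 2) (f u⁻¹) u := by
  refine ((hasDerivAt_integral_div_sq hf ha (inv_pos.2 hu)).comp u
    (hasDerivAt_inv hu.ne')).neg.congr_deriv ?_
  field_simp

theorem lintegral_div_sq_ne_top_of_bounded (hf : ContinuousOn f (Ioi 0))
    (hf0 : ∀ η, 0 < η → 0 ≤ f η)
    {a M : ℝ} (ha : 0 < a) (h : ∀ R, a < R → ∫ η in a..R, f η / η ^ 2 ≤ M) :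
    (∫⁻ η in Ioi a, ENNReal.ofReal (f η / η ^ 2)) ≠ ⊤ := by
  have hint : IntegrableOn (fun η => f η / η ^ 2) (Ioi a) := by
    refine integrableOn_Ioi_of_intervalIntegral_norm_bounded M a (b := fun R : ℝ => R) (l := atTop)
      (fun R => ?_) tendsto_id ?_
    · refine (((continuousOn_div_sq hf).mono fun η hη => ?_).integrableOn_Icc
        (a := a) (b := R)).mono_set Ioc_subset_Icc_self
      exact ha.trans_le hη.1
    · filter_upwards [eventually_gt_atTop a] with R hR
      refine le_of_eq_of_le (intervalIntegral.integral_congr fun η hη => ?_) (h R hR)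
      rw [uIcc_of_le hR.le] at hη
      have hη0 : 0 < η := ha.trans_le hη.1
      have := hf0 η hη0
      exact Real.norm_of_nonneg (by positivity)
  exact hint.lintegral_lt_top.ne

/-- All positive `R` are allowed, also those below `a`, because `R = 1 / s` will range over the
whole half-line. Below `a` the integral is nonpositive. -/
theorem exists_integral_div_sq_le (hf : ContinuousOn f (Ioi 0)) (hf0 : ∀ η, 0 < η → 0 ≤ f η)
    {a : ℝ} (ha : 0 < a) (h : (∫⁻ η in Ioi a, ENNReal.ofReal (f η / η ^ 2)) ≠ ⊤) :
    ∃ M, ∀ R, 0 < R → ∫ η in a..R, f η / η ^ 2 ≤ M := by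
  have hnn : ∀ η, 0 < η → 0 ≤ f η / η ^ 2 := fun η hη => div_nonneg (hf0 η hη) (sq_nonneg η)
  have hint : IntegrableOn (fun η => f η / η ^ 2) (Ioi a) := by
    refine ⟨((continuousOn_div_sq hf).mono (Ioi_subset_Ioi ha.le)).aestronglyMeasurable
      measurableSet_Ioi, ?_⟩
    rw [hasFiniteIntegral_iff_ofReal]
    · exact h.lt_top
    · filter_upwards [ae_restrict_mem measurableSet_Ioi] with η hη using hnn η (ha.trans hη)
  refine ⟨∫ η in Ioi a, f η / η ^ 2, fun R hR => ?_⟩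
  have h0 : 0 ≤ᵐ[volume.restrict (Ioi a)] fun η => f η / η ^ 2 := by
    filter_upwards [ae_restrict_mem measurableSet_Ioi] with η hη using hnn η (ha.trans hη)
  rcases le_total a R with haR | haR
  · rw [intervalIntegral.integral_of_le haR]
    exact setIntegral_mono_set hint h0 (Ioc_subset_Ioi_self.eventuallyLE)
  · rw [intervalIntegral.integral_symm]
    have h1 : 0 ≤ ∫ η in R..a, f η / η ^ 2 :=
      intervalIntegral.integral_nonneg haR fun η hη => hnn η (hR.trans_le hη.1)
    have h2 : 0 ≤ ∫ η in Ioi a, f η / η ^ 2 := integral_nonneg_of_ae h0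
    linarith

theorem monotoneOn_integral_div_sq (hf : ContinuousOn f (Ioi 0)) (hf0 : ∀ η, 0 < η → 0 ≤ f η)
    {a : ℝ} (ha : 0 < a) : MonotoneOn (fun R => ∫ η in a..R, f η / η ^ 2) (Ioi 0) := by
  refine monotoneOn_of_deriv_nonneg (convex_Ioi 0)
    (fun s hs => (hasDerivAt_integral_div_sq hf ha hs).continuousAt.continuousWithinAt)
    (fun s hs => (hasDerivAt_integral_div_sq hf ha
      (interior_subset hs)).differentiableAt.differentiableWithinAt) fun s hs => ?_
  have hs : 0 < s := interior_subset (s := Ioi (0 : ℝ)) hs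
  rw [(hasDerivAt_integral_div_sq hf ha hs).deriv]
  exact div_nonneg (hf0 s hs) (sq_nonneg s)

end Potential

/-! ### Global existence and blow-up -/

/-- A maximal analytic solution of the system of the affine flow. -/
theorem exists_maximal_affineFlow {ν : ℝ → ℝ} (hν : AnalyticOnNhd ℝ ν (Ioi 0))
    {u₀ : ℝ} (hu₀ : 0 < u₀) (w₀ q₀ r₀ : ℝ) :
    ∃ δ > 0, ∃ u w q r : ℝ → ℝ, u 0 = u₀ ∧ w 0 = w₀ ∧ q 0 = q₀ ∧ r 0 = r₀ ∧
      ((IsAffineFlow ν (Ioi (-δ)) u w q r ∧ ∀ t ∈ Ioi (-δ), AnalyticAt ℝ u t ∧ AnalyticAt ℝ w t ∧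
          AnalyticAt ℝ q t ∧ AnalyticAt ℝ r t) ∨
        ∃ T > 0, IsAffineFlow ν (Ioo (-δ) T) u w q r ∧
          (∀ t ∈ Ioo (-δ) T, AnalyticAt ℝ u t ∧ AnalyticAt ℝ w t ∧
            AnalyticAt ℝ q t ∧ AnalyticAt ℝ r t) ∧
          ∀ m M : ℝ, 0 < m → ∃ t ∈ Ico 0 T,
            ¬ (m ≤ u t ∧ |u t| ≤ M ∧ |w t| ≤ M ∧ |q t| ≤ M ∧ |r t| ≤ M)) := by
  obtain ⟨δ, hδ, y, hy0, hy⟩ := IsTrajectoryOn.exists_maximal (analyticOnNhd_affineField hν)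
    isOpen_fst_pos (y₀ := (u₀, w₀, q₀, r₀)) hu₀
  have han : ∀ {I : Set ℝ}, IsOpen I → IsTrajectoryOn (affineField ν) {p | 0 < p.1} I y →
      ∀ t ∈ I, AnalyticAt ℝ (fun t => (y t).1) t ∧ AnalyticAt ℝ (fun t => (y t).2.1) t ∧
        AnalyticAt ℝ (fun t => (y t).2.2.1) t ∧ AnalyticAt ℝ (fun t => (y t).2.2.2) t := by
    intro I hI h t ht
    have ha := h.analyticOnNhd hI (analyticOnNhd_affineField hν) t ht
    have h2 := analyticAt_snd_comp ha
    have h3 := analyticAt_snd_comp h2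
    exact ⟨analyticAt_fst_comp ha, analyticAt_fst_comp h2, analyticAt_fst_comp h3,
      analyticAt_snd_comp h3⟩
  refine ⟨δ, hδ, fun t => (y t).1, fun t => (y t).2.1, fun t => (y t).2.2.1,
    fun t => (y t).2.2.2, by simp [hy0], by simp [hy0], by simp [hy0], by simp [hy0], ?_⟩
  rcases hy with hy | ⟨T, hT, hy, hK⟩
  · exact .inl ⟨isAffineFlow_of_isTrajectoryOn hy, han isOpen_Ioi hy⟩
  · refine .inr ⟨T, hT, isAffineFlow_of_isTrajectoryOn hy, han isOpen_Ioo hy, fun m M hm => ?_⟩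
    obtain ⟨t, ht, hn⟩ := hK (Icc m M ×ˢ (Icc (-M) M ×ˢ (Icc (-M) M ×ˢ Icc (-M) M)))
      (fun p hp => hm.trans_le hp.1.1)
      (isCompact_Icc.prod (isCompact_Icc.prod (isCompact_Icc.prod isCompact_Icc)))
    refine ⟨t, ht, fun h => hn ?_⟩
    exact ⟨⟨h.1, (abs_le.1 h.2.1).2⟩, abs_le.1 h.2.2.1, abs_le.1 h.2.2.2.1, abs_le.1 h.2.2.2.2⟩

/-- With these bounds, the approach of `u` to `0` is the only way to leave every compact subset of
the domain. -/
theorem IsAffineFlow.abs_le {ν : ℝ → ℝ} {T : ℝ} {u w q r : ℝ → ℝ}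
    (h : IsAffineFlow ν (Ico 0 T) u w q r) (hν : ∀ n, 0 < n → 0 ≤ ν n) :
    ∀ t ∈ Ico 0 T, |u t| ≤ √((u 0 - 1) ^ 2 + w 0 ^ 2) + 1 ∧
      |w t| ≤ √((u 0 - 1) ^ 2 + w 0 ^ 2) ∧
      |q t| ≤ √(q 0 ^ 2 + r 0 ^ 2) ∧ |r t| ≤ √(q 0 ^ 2 + r 0 ^ 2) := by
  intro t ht
  have h1 := h.energy_uw hν ht
  have h2 := h.energy_qr hν ht
  have hu : |u t - 1| ≤ √((u 0 - 1) ^ 2 + w 0 ^ 2) :=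
    Real.abs_le_sqrt (by nlinarith [sq_nonneg (w t)])
  refine ⟨?_, Real.abs_le_sqrt (by nlinarith [sq_nonneg (u t - 1)]),
    Real.abs_le_sqrt (by nlinarith [sq_nonneg (r t)]),
    Real.abs_le_sqrt (by nlinarith [sq_nonneg (q t)])⟩
  calc |u t| = |(u t - 1) + 1| := by ring_nf
    _ ≤ |u t - 1| + |1| := abs_add_le _ _
    _ ≤ _ := by rw [abs_one]; gcongr

/-- If the potential is unbounded below at `0`, the flow stays away from infinite density. -/
theorem exists_pos_le_of_unbounded {ν Φ : ℝ → ℝ} (hν : ∀ n, 0 < n → 0 ≤ ν n)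
    (hΦ : ∀ s, 0 < s → HasDerivAt Φ (ν s⁻¹) s)
    (hub : ∀ M : ℝ, ∃ m > 0, ∀ s, 0 < s → s < m → Φ s < M) (u₀ w₀ : ℝ) :
    ∃ m > 0, ∀ (T : ℝ) (u w q r : ℝ → ℝ), IsAffineFlow ν (Ico 0 T) u w q r → u 0 = u₀ → w 0 = w₀ →
      ∀ t ∈ Ico 0 T, m ≤ u t := by
  set C := √((u₀ - 1) ^ 2 + w₀ ^ 2)
  -- The Liénard variable is at least this minimum and `w ≤ C`, so `Φ(u)` is never below the
  -- difference.
  obtain ⟨m, hm, hlt⟩ := hub (min (w₀ + Φ u₀) (-C + Φ 1) - C)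
  refine ⟨m, hm, fun T u w q r h hu hw t ht => ?_⟩
  have hC : ∀ t ∈ Ico 0 T, |w t| ≤ C := fun t ht => by
    have := (h.abs_le hν t ht).2.1
    rwa [hu, hw] at this
  have h1 := h.le_lienard hν hΦ (fun t ht => (_root_.abs_le.1 (hC t ht)).1) ht
  rw [hu, hw] at h1
  by_contra! hcon
  have h2 := hlt (u t) (h.pos t ht) hcon
  linarith [(_root_.abs_le.1 (hC t ht)).2]

theorem mem_Ici_initial {t : ℝ} (ht : t ∈ Ici (0 : ℝ)) :
    0 ≤ t ∧ Icc 0 t ⊆ Ici 0 ∧ ∃ s ∈ Ici (0 : ℝ), t < s :=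
  ⟨ht, fun _ hs => hs.1, t + 1, by simp only [mem_Ici] at *; linarith, by linarith⟩

theorem mem_Ico_initial {T t : ℝ} (ht : t ∈ Ico (0 : ℝ) T) :
    0 ≤ t ∧ Icc 0 t ⊆ Ico 0 T ∧ ∃ s ∈ Ico (0 : ℝ) T, t < s :=
  ⟨ht.1, fun _ hs => ⟨hs.1, hs.2.trans_lt ht.2⟩, (t + T) / 2,
    ⟨by linarith [ht.1, ht.2], by linarith [ht.2]⟩, by linarith [ht.2]⟩

/-- Global bounded affine solutions when the potential is unbounded. -/
theorem exists_global_solution {ν Φ : ℝ → ℝ} (hνa : AnalyticOnNhd ℝ ν (Ioi 0))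
    (hν : ∀ n, 0 < n → 0 ≤ ν n) (hΦ : ∀ s, 0 < s → HasDerivAt Φ (ν s⁻¹) s)
    (hub : ∀ M : ℝ, ∃ m > 0, ∀ s, 0 < s → s < m → Φ s < M) (a₀ A₀ : ℝ) {b₀ : ℝ} (B₀ : ℝ)
    (hb₀ : b₀ < 1) :
    ∃ V E : ℝ → ℝ → ℝ,
      IsSolution ν (Ici 0) (fun x => a₀ * x + A₀) (fun x => b₀ * x + B₀) V E ∧
      IsUniqueOn ν (Ici 0) (fun x => a₀ * x + A₀) (fun x => b₀ * x + B₀) V E ∧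
      IsAffineOn (Ici 0) V ∧ IsAffineOn (Ici 0) E ∧
      ∃ M : ℝ, ∀ t : ℝ, 0 ≤ t → ∀ x : ℝ, |deriv (V t) x| ≤ M ∧ |deriv (E t) x| ≤ M := by
  have hn₀ : 0 < 1 - b₀ := by linarith
  -- The initial density is `1 - b₀`, whence `u 0 = 1 / (1 - b₀)` and `w 0 = a₀ / (1 - b₀)`; `q` and
  -- `r` start from the values `B₀`, `A₀` of `E`, `V` at the origin.
  obtain ⟨δ, hδ, u, w, q, r, hu0, hw0, hq0, hr0, hmax⟩ :=
    exists_maximal_affineFlow hνa (inv_pos.2 hn₀) (a₀ * (1 - b₀)⁻¹) B₀ A₀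
  obtain ⟨m, hm, hlow⟩ := exists_pos_le_of_unbounded hν hΦ hub (1 - b₀)⁻¹ (a₀ * (1 - b₀)⁻¹)
  rcases hmax with ⟨h, han⟩ | ⟨T, hT, h, -, hK⟩
  · have hsub : Ici (0 : ℝ) ⊆ Ioi (-δ) := fun t ht => by
      simp only [mem_Ici, mem_Ioi] at *; linarith
    have h' := h.mono hsub
    have hsol : IsSolution ν (Ici 0) (fun x => a₀ * x + A₀) (fun x => b₀ * x + B₀)
        (affineVelocity u w q r) (affineElectric u q) := by
      refine h'.isSolution (uniqueDiffOn_Ici 0) (fun t ht => (han t (hsub ht)).1)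
        (fun t ht => (han t (hsub ht)).2.1) (fun t ht => (han t (hsub ht)).2.2.1)
        (fun t ht => (han t (hsub ht)).2.2.2) ?_ hr0 ?_ hq0
      · rw [hw0, hu0]; field_simp
      · rw [hu0, inv_inv]; ring
    refine ⟨_, _, hsol, hsol.isUniqueOn hνa fun t ht => mem_Ici_initial ht,
      isAffineOn_affineVelocity _ _ _ _ _, isAffineOn_affineElectric _ _ _, ?_⟩
    set C := √((u 0 - 1) ^ 2 + w 0 ^ 2)
    refine ⟨max (C / m) (1 + m⁻¹), fun t ht x => ?_⟩
    -- The bounds concern finite intervals `[0, T)`; any `T > t` serves, since `m` and `C` do not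
    -- depend on it.
    have hI : Ico 0 (t + 1) ⊆ Ici 0 := fun s hs => hs.1
    have htI : t ∈ Ico 0 (t + 1) := ⟨ht, by linarith⟩
    have hmu : m ≤ u t := hlow (t + 1) u w q r (h'.mono hI) hu0 hw0 t htI
    have hwC : |w t| ≤ C := ((h'.mono hI).abs_le hν t htI).2.1
    have hut : 0 < u t := hm.trans_le hmu
    rw [deriv_affineVelocity, deriv_affineElectric]
    constructor
    · refine le_trans ?_ (le_max_left _ _)
      rw [abs_div, abs_of_pos hut]
      exact div_le_div₀ (Real.sqrt_nonneg _) hwC hm hmu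
    · refine le_trans ?_ (le_max_right _ _)
      have h1 : (u t)⁻¹ ≤ m⁻¹ := inv_anti₀ hm hmu
      have h2 : 0 < (u t)⁻¹ := inv_pos.2 hut
      rw [_root_.abs_le]
      constructor <;> linarith
  · exfalso
    have h' : IsAffineFlow ν (Ico 0 T) u w q r :=
      h.mono fun t ht => ⟨by linarith [ht.1], ht.2⟩
    set C := √((u 0 - 1) ^ 2 + w 0 ^ 2)
    set D := √(q 0 ^ 2 + r 0 ^ 2)
    obtain ⟨t, ht, hn⟩ := hK m (max (C + 1) D) hm
    obtain ⟨h1, h2, h3, h4⟩ := h'.abs_le hν t ht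
    refine hn ⟨hlow T u w q r h' hu0 hw0 t ht, h1.trans (le_max_left _ _),
      h2.trans ((le_add_of_nonneg_right zero_le_one).trans (le_max_left _ _)),
      h3.trans (le_max_right _ _), h4.trans (le_max_right _ _)⟩

/-- Data whose affine solution blows up, when the potential is bounded below. -/
theorem exists_blowup_solution {ν Φ : ℝ → ℝ} (hνa : AnalyticOnNhd ℝ ν (Ioi 0))
    (hν : ∀ n, 0 < n → 0 ≤ ν n) (hΦ : ∀ s, 0 < s → HasDerivAt Φ (ν s⁻¹) s)
    {B : ℝ} (hB : ∀ s, 0 < s → -B ≤ Φ s) :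
    ∃ a₀ A₀ b₀ B₀ : ℝ, b₀ < 1 ∧ ∃ T : ℝ, 0 < T ∧ ∃ V E : ℝ → ℝ → ℝ,
      IsSolution ν (Ico 0 T) (fun x => a₀ * x + A₀) (fun x => b₀ * x + B₀) V E ∧
      IsUniqueOn ν (Ico 0 T) (fun x => a₀ * x + A₀) (fun x => b₀ * x + B₀) V E ∧
      IsAffineOn (Ico 0 T) V ∧ IsAffineOn (Ico 0 T) E ∧
      ∀ x : ℝ, Tendsto (fun t => |deriv (V t) x|) (𝓝[<] T) atTop ∧
        Tendsto (fun t => |deriv (E t) x|) (𝓝[<] T) atTop := by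
  -- With `u 0 = 1`, `w 0 = -(Φ 1 + B + 3)`, the bound `w + Φ(u) ≤ w 0 + Φ 1 + t` and `Φ ≥ -B` give
  -- `w ≤ t - 3`. So `u' ≤ -1` up to time `2`, more than is needed to bring `u` from `1` to `0`.
  obtain ⟨δ, hδ, u, w, q, r, hu0, hw0, hq0, hr0, hmax⟩ :=
    exists_maximal_affineFlow hνa one_pos (-(Φ 1 + B + 3)) 0 0
  have hwle : ∀ {T : ℝ}, IsAffineFlow ν (Ico 0 T) u w q r → ∀ t ∈ Ico 0 T, w t ≤ t - 3 := by
    intro T h t ht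
    have h1 := h.lienard_le hΦ ht
    rw [hu0, hw0] at h1
    linarith [hB _ (h.pos t ht)]
  have hanti : ∀ {T : ℝ}, IsAffineFlow ν (Ico 0 T) u w q r → T ≤ 2 →
      AntitoneOn (fun t => u t + t) (Ico 0 T) := by
    intro T h hT
    have hd : ∀ t ∈ Ico 0 T, HasDerivAt (fun t => u t + t) (w t + 1) t := fun t ht =>
      (h.deriv_u t ht).add (hasDerivAt_id t)
    refine antitoneOn_of_deriv_nonpos (convex_Ico 0 T)
      (fun s hs => (hd s hs).continuousAt.continuousWithinAt)
      (fun s hs => (hd s (interior_subset hs)).differentiableAt.differentiableWithinAt)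
      fun s hs => ?_
    rw [(hd s (interior_subset hs)).deriv]
    linarith [hwle h s (interior_subset hs), (interior_subset hs : s ∈ Ico 0 T).2]
  -- A flow living past time `1` would have `u(1) + 1 ≤ u(0) = 1`. The cut at `min T 2` meets the
  -- condition of `hanti`.
  have hlife : ∀ {T : ℝ}, IsAffineFlow ν (Ico 0 T) u w q r → T ≤ 1 := by
    intro T h
    by_contra! hT
    have hmin : 1 < min T 2 := lt_min hT one_lt_two
    have h' : IsAffineFlow ν (Ico 0 (min T 2)) u w q r :=
      h.mono (Ico_subset_Ico_right (min_le_left _ _))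
    have h1 := hanti h' (min_le_right _ _) ⟨le_rfl, by linarith⟩ ⟨zero_le_one, hmin⟩ zero_le_one
    simp only [hu0] at h1
    linarith [h'.pos 1 ⟨zero_le_one, hmin⟩]
  rcases hmax with ⟨h, -⟩ | ⟨T, hT, h, han, hK⟩
  · have : IsAffineFlow ν (Ico 0 2) u w q r := h.mono fun t ht => by
      simp only [mem_Ioi]; linarith [ht.1]
    linarith [hlife this]
  have hsub : Ico 0 T ⊆ Ioo (-δ) T := fun t ht => ⟨by linarith [ht.1], ht.2⟩
  have h' := h.mono hsub
  have hT1 : T ≤ 1 := hlife h'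
  have hw2 : ∀ t ∈ Ico 0 T, w t ≤ -2 := fun t ht => by linarith [hwle h' t ht, ht.2]
  have hu_anti : AntitoneOn u (Ico 0 T) := by
    intro s hs t ht hst
    have := hanti h' (by linarith) hs ht hst
    simp only at this
    linarith
  -- All other coordinates are bounded, so leaving the compact sets forces `u` below every `m > 0`;
  -- monotonicity of `u` turns this into a limit.
  have hsmall : ∀ m, 0 < m → ∃ t ∈ Ico 0 T, u t < m := by
    intro m hm
    set C := √((u 0 - 1) ^ 2 + w 0 ^ 2)
    set D := √(q 0 ^ 2 + r 0 ^ 2)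
    obtain ⟨t, ht, hn⟩ := hK m (max (C + 1) D) hm
    obtain ⟨h1, h2, h3, h4⟩ := h'.abs_le hν t ht
    refine ⟨t, ht, ?_⟩
    by_contra! hcon
    exact hn ⟨hcon, h1.trans (le_max_left _ _),
      h2.trans ((le_add_of_nonneg_right zero_le_one).trans (le_max_left _ _)),
      h3.trans (le_max_right _ _), h4.trans (le_max_right _ _)⟩
  have hlim : Tendsto (fun t => (u t)⁻¹) (𝓝[<] T) atTop := by
    rw [tendsto_atTop]
    intro c
    have hc : 0 < max c 1 := lt_max_of_lt_right one_pos
    obtain ⟨s, hs, hus⟩ := hsmall _ (inv_pos.2 hc)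
    filter_upwards [Ico_mem_nhdsLT hs.2] with t ht
    have ht' : t ∈ Ico 0 T := ⟨hs.1.trans ht.1, ht.2⟩
    have h1 : u t ≤ (max c 1)⁻¹ := (hu_anti hs ht' ht.1).trans hus.le
    have h2 := inv_anti₀ (h'.pos t ht') h1
    rw [inv_inv] at h2
    exact (le_max_left _ _).trans h2
  have hsol : IsSolution ν (Ico 0 T) (fun x => -(Φ 1 + B + 3) * x + 0) (fun x => 0 * x + 0)
      (affineVelocity u w q r) (affineElectric u q) := by
    refine h'.isSolution (uniqueDiffOn_Ico 0 T) (fun t ht => (han t (hsub ht)).1)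
      (fun t ht => (han t (hsub ht)).2.1) (fun t ht => (han t (hsub ht)).2.2.1)
      (fun t ht => (han t (hsub ht)).2.2.2) ?_ hr0 ?_ hq0
    · rw [hw0, hu0, div_one]
    · rw [hu0, inv_one, sub_self]
  refine ⟨_, 0, 0, 0, one_pos, T, hT, _, _, hsol, hsol.isUniqueOn hνa fun t ht => mem_Ico_initial ht,
    isAffineOn_affineVelocity _ _ _ _ _, isAffineOn_affineElectric _ _ _, fun x => ?_⟩
  simp only [deriv_affineVelocity, deriv_affineElectric]
  have hIco : Ico 0 T ∈ 𝓝[<] T := Ico_mem_nhdsLT hT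
  constructor
  · refine tendsto_atTop_mono' _ ?_ hlim
    filter_upwards [hIco] with t ht
    have h1 : 0 < (u t)⁻¹ := inv_pos.2 (h'.pos t ht)
    rw [div_eq_mul_inv, abs_mul, abs_of_pos h1, abs_of_neg (by linarith [hw2 t ht])]
    nlinarith [hw2 t ht]
  · refine tendsto_atTop_mono' _ ?_ (tendsto_atTop_add_const_right _ (-1) hlim)
    filter_upwards with t
    rw [abs_sub_comm]
    exact le_abs_self _

end ColdPlasma

/-! ### The dichotomy -/

theorem theorem1 (f : ℝ → ℝ) (hf : AnalyticOnNhd ℝ f (Ioi 0)) (hf0 : ∀ η, 0 < η → 0 ≤ f η)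
    (ε : ℝ) (hε : 0 < ε) (η₀ : ℝ) (hη₀ : 0 < η₀) :
    ((∫⁻ η in Ioi η₀, ENNReal.ofReal (f η / η ^ 2)) = ⊤ →
      ∀ a₀ A₀ b₀ B₀ : ℝ, b₀ < 1 →
        ∃ V E : ℝ → ℝ → ℝ,
          ColdPlasma.IsSolution (fun n => ε * f n) (Ici 0)
            (fun x => a₀ * x + A₀) (fun x => b₀ * x + B₀) V E ∧
          ColdPlasma.IsUniqueOn (fun n => ε * f n) (Ici 0)
            (fun x => a₀ * x + A₀) (fun x => b₀ * x + B₀) V E ∧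
          ColdPlasma.IsAffineOn (Ici 0) V ∧ ColdPlasma.IsAffineOn (Ici 0) E ∧
          ∃ M : ℝ, ∀ t : ℝ, 0 ≤ t → ∀ x : ℝ, |deriv (V t) x| ≤ M ∧ |deriv (E t) x| ≤ M) ∧
    ((∫⁻ η in Ioi η₀, ENNReal.ofReal (f η / η ^ 2)) ≠ ⊤ →
      ∃ a₀ A₀ b₀ B₀ : ℝ, b₀ < 1 ∧
        ∃ T : ℝ, 0 < T ∧ ∃ V E : ℝ → ℝ → ℝ,
          ColdPlasma.IsSolution (fun n => ε * f n) (Ico 0 T)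
            (fun x => a₀ * x + A₀) (fun x => b₀ * x + B₀) V E ∧
          ColdPlasma.IsUniqueOn (fun n => ε * f n) (Ico 0 T)
            (fun x => a₀ * x + A₀) (fun x => b₀ * x + B₀) V E ∧
          ColdPlasma.IsAffineOn (Ico 0 T) V ∧ ColdPlasma.IsAffineOn (Ico 0 T) E ∧
          ∀ x : ℝ, Tendsto (fun t => |deriv (V t) x|) (𝓝[<] T) atTop ∧
            Tendsto (fun t => |deriv (E t) x|) (𝓝[<] T) atTop) := by
  have hνa : AnalyticOnNhd ℝ (fun n => ε * f n) (Ioi 0) := analyticOnNhd_const.mul hf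
  have hν : ∀ n, 0 < n → 0 ≤ ε * f n := fun n hn => mul_nonneg hε.le (hf0 n hn)
  have hΦ : ∀ s, 0 < s →
      HasDerivAt (fun u => ε * -∫ η in η₀..u⁻¹, f η / η ^ 2) (ε * f s⁻¹) s := fun s hs =>
    (ColdPlasma.hasDerivAt_neg_integral_inv hf.continuousOn hη₀ hs).const_mul ε
  constructor
  · intro htop a₀ A₀ b₀ B₀ hb₀
    refine ColdPlasma.exists_global_solution hνa hν hΦ (fun M => ?_) a₀ A₀ B₀ hb₀
    -- An integral above `-M / ε` means `Φ < M`; monotonicity in the upper limit extends this to all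
    -- `s` with `1 / s ≥ R`.
    obtain ⟨R, hR, hlt⟩ : ∃ R, η₀ < R ∧ -M / ε < ∫ η in η₀..R, f η / η ^ 2 := by
      by_contra! hcon
      exact ColdPlasma.lintegral_div_sq_ne_top_of_bounded hf.continuousOn hf0 hη₀ hcon htop
    have hR0 : 0 < R := hη₀.trans hR
    refine ⟨R⁻¹, inv_pos.2 hR0, fun s hs hsR => ?_⟩
    have h1 : R ≤ s⁻¹ := by
      have := inv_anti₀ hs hsR.le
      rwa [inv_inv] at this
    have h2 := hlt.trans_le (ColdPlasma.monotoneOn_integral_div_sq hf.continuousOn hf0 hη₀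
      (mem_Ioi.2 hR0) (mem_Ioi.2 (inv_pos.2 hs)) h1)
    rw [div_lt_iff₀ hε] at h2
    linarith
  · intro hfin
    obtain ⟨M, hM⟩ := ColdPlasma.exists_integral_div_sq_le hf.continuousOn hf0 hη₀ hfin
    refine ColdPlasma.exists_blowup_solution hνa hν hΦ (B := ε * M) fun s hs => ?_
    have := mul_le_mul_of_nonneg_left (hM s⁻¹ (inv_pos.2 hs)) hε.le
    linarith
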